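/- **Theorem.** For $\beta\in\mathbb R$ let $\mathcal F'_\beta$ be the equation $u_t+xu_y=|x|^\beta u_{xx}$ for $u=u(t,x,y)$, considered where $x\ne0$, and let $\mathcal F'=\{\mathcal F'_\beta\mid\beta\in\mathbb R\}$. For an open set $\Omega\subseteq\mathbb R^4_{t,x,y,u}$, an *equivalence transformation* of $\mathcal F'$ with domain $\Omega\times\mathbb R_\beta$ is an injective $C^\infty$ map $\Psi\colon\Omega\times\mathbb R\to\mathbb R^5$, $(t,x,y,u,\beta)\mapsto(\tilde t,\tilde x,\tilde y,\tilde u,\tilde\beta)$, with nonvanishing Jacobian such that $(\tilde t,\tilde x,\tilde y,\tilde u)=\varphi(t,x,y,u)$ does not depend on $\beta$ and, for every $\beta\in\mathbb R$, the component $\tilde\beta$ is constant on $\Omega\times\{\beta\}$ and $\varphi$ maps $\mathcal F'_\beta$ to $\mathcal F'_{\tilde\beta}$; the latter means that, at points with $x\ne0$ and $\tilde x\ne0$, the second prolongation of $\varphi$ maps 2-jets satisfying $\mathcal F'_\beta$, and only those, to 2-jets satisfying $\mathcal F'_{\tilde\beta}$. (1) If $\Omega$ is nonempty, open and connected, then the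 equivalence transformations of $\mathcal F'$ with domain $\Omega\times\mathbb R$ are exactly the maps of the following two forms, the second one occurring only if $x\neq0$ on $\Omega$: $$\tilde t=t+c_0,\quad \tilde x=\epsilon x,\quad \tilde y=\epsilon y+c_1,\quad \tilde u=c_2u+c_3(tx-y)+c_4x+c_5,\quad \tilde\beta=\beta;\tag{A}$$ $$\tilde t=\varepsilon' y+c_0',\quad \tilde x=\frac{\epsilon'}x,\quad \tilde y=\epsilon'\varepsilon' t+c_1',\quad \tilde u=\frac{c_2'}xu+c_3'\Big(t-\frac yx\Big)+\frac{c_4'}x+c_5',\quad \tilde\beta=5-\beta,\tag{B}$$ where $\epsilon,\epsilon'\in\{\pm1\}$, $\varepsilon'=\operatorname{sgn}x$, and $c_0,\dots,c_5,c_0',\dots,c_5'$ are arbitrary real constants with $c_2c_2'\ne0$. (2) For every open $\Omega$ (connected or not), each map of the form (A) on $\Omega\times\mathbb R$ and, if $x\ne0$ on $\Omega$, each map of the form (B) on $\Omega\times\mathbb R$ is an equivalence transformation of $\mathcal F'$. (3) If $\Omega$ is nonempty, open and connected and $x\neq0$ on $\Omega$, then the maps of the form (B) on $\Omega\times\mathbb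 R$ are exactly the restrictions to $\Omega\times\mathbb R$ of the compositions $\Psi_A\circ\mathscr J'$, where $\Psi_A$ is of the form (A) and $\mathscr J'\colon(t,x,y,u,\beta)\mapsto(y\operatorname{sgn}x,\,1/x,\,t\operatorname{sgn}x,\,u/x,\,5-\beta)$. -/

import Mathlib

open Set Filter Topology
open scoped ContDiff

namespace KolmogorovPower

/-- The space of the independent variables `(t, x, y)`. -/
abbrev Base : Type := ℝ × ℝ × ℝ

/-- The space of all variables `((t, x, y), u)`. -/
abbrev Vars : Type := Base × ℝ

/-- The joint space of variables and arbitrary element, `(((t, x, y), u), β)`. -/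
abbrev Total : Type := Vars × ℝ

/-- The function `f` satisfies `u_t + x u_y = |x|^β u_xx` at the point `z = (t, x, y)`. For `f` of
class `C²` near `z` this depends on the 2-jet of `f` at `z` only: it says that this jet lies on the
submanifold of the second-order jet space given by the equation. -/
def SatisfiesAt (β : ℝ) (f : Base → ℝ) (z : Base) : Prop :=
  fderiv ℝ f z (1, 0, 0) + z.2.1 * fderiv ℝ f z (0, 0, 1) =
    |z.2.1| ^ β * fderiv ℝ (fun w => fderiv ℝ f w (0, 1, 0)) z (0, 1, 0)

/-- The point transformation `φ` with domain `Ω` maps the equation with parameter `β` onto the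
equation with parameter `β'`: its second prolongation, that is, its action on 2-jets of functions by
transforming their graphs, carries the jets on the first equation, and no other ones, to jets on the
second. Here `g` is the function whose graph is the image of the graph of `f` near the point
considered. The equations are regarded away from the hyperplane `x = 0`, where the coefficient
`|x|^β` is singular or degenerate. -/
def MapsEquation (Ω : Set Vars) (φ : Vars → Vars) (β β' : ℝ) : Prop :=
  ∀ (z : Base) (f g : Base → ℝ),
    (z, f z) ∈ Ω → z.2.1 ≠ 0 → (φ (z, f z)).1.2.1 ≠ 0 →
    ContDiffAt ℝ 2 f z → ContDiffAt ℝ 2 g (φ (z, f z)).1 →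
    (∀ᶠ w in 𝓝 z, g (φ (w, f w)).1 = (φ (w, f w)).2) →
    (SatisfiesAt β f z ↔ SatisfiesAt β' g (φ (z, f z)).1)

/-- `Ψ` is a (usual) equivalence transformation, with domain `Ω × ℝ`, of the class of all equations
`u_t + x u_y = |x|^β u_xx`, `β ∈ ℝ`: a smooth invertible transformation with nonzero Jacobian in the
space of `(t, x, y, u, β)` that is projectable to the space of `(t, x, y, u)` and maps every
equation of the class to an equation of the class. -/
structure IsEquivalenceTransformation (Ω : Set Vars) (Ψ : Total → Total) : Prop where
  smooth : ContDiffOn ℝ ∞ Ψ (Ω ×ˢ univ)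
  injOn : InjOn Ψ (Ω ×ˢ univ)
  jacobian_ne_zero : ∀ q ∈ Ω ×ˢ (univ : Set ℝ), (fderiv ℝ Ψ q).det ≠ 0
  maps_class : ∃ φ : Vars → Vars,
    (∀ p ∈ Ω, ∀ β : ℝ, (Ψ (p, β)).1 = φ p) ∧
    ∀ β : ℝ, ∃ β' : ℝ, (∀ p ∈ Ω, (Ψ (p, β)).2 = β') ∧ MapsEquation Ω φ β β'

/-- On `Ω × ℝ`, `Ψ` is a transformation of the first family, with `β` unchanged. -/
def IsFirstForm (Ω : Set Vars) (Ψ : Total → Total) : Prop :=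
  ∃ ε c₀ c₁ c₂ c₃ c₄ c₅ : ℝ, (ε = 1 ∨ ε = -1) ∧ c₂ ≠ 0 ∧
    ∀ t x y u β : ℝ, ((t, x, y), u) ∈ Ω →
      Ψ (((t, x, y), u), β) =
        (((t + c₀, ε * x, ε * y + c₁),
          c₂ * u + c₃ * (t * x - y) + c₄ * x + c₅), β)

/-- On `Ω × ℝ`, where `Ω` does not meet the hyperplane `x = 0`, `Ψ` is a transformation of the
second family, with `β` replaced by `5 - β`. -/
def IsSecondForm (Ω : Set Vars) (Ψ : Total → Total) : Prop :=
  (∀ p ∈ Ω, p.1.2.1 ≠ 0) ∧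
  ∃ ε c₀ c₁ c₂ c₃ c₄ c₅ : ℝ, (ε = 1 ∨ ε = -1) ∧ c₂ ≠ 0 ∧
    ∀ t x y u β : ℝ, ((t, x, y), u) ∈ Ω →
      Ψ (((t, x, y), u), β) =
        (((Real.sign x * y + c₀, ε / x, ε * Real.sign x * t + c₁),
          c₂ / x * u + c₃ * (t - y / x) + c₄ / x + c₅), 5 - β)

/-- The discrete transformation `(t, x, y, u, β) ↦ (y sgn x, 1/x, t sgn x, u/x, 5 - β)`, to be
used for `x ≠ 0` only. -/
noncomputable def discreteJ (q : Total) : Total :=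
  (((q.1.1.2.2 * Real.sign q.1.1.2.1, 1 / q.1.1.2.1, q.1.1.1 * Real.sign q.1.1.2.1),
    q.1.2 / q.1.1.2.1), 5 - q.2)

end KolmogorovPower

/-!
A point transformation `φ = (t̃, x̃, ỹ, ũ)` acts on 2-jets of functions, and the argument compares this
action with the two equations.

*Determining equations.* By the inverse function theorem, at a point with `x, x̃ ≠ 0` every 2-jet whose
graph is transversal to the fibres of `(t̃, x̃, ỹ)` is the jet of a quadratic polynomial `f` for which
a transformed function `g` exists (`MapsEquation.jet_iff`). Its Hessian in the direction `∂/∂x̃` is,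
up to a nonzero factor and lower-order terms, the Hessian of `f` in the corresponding direction `a`
on the graph (`hessian_transform`). As the equation leaves all second derivatives except `f_xx` free,
`a` is proportional to `∂/∂x` (`MapsEquation.direction`), so `t̃` and `ỹ` depend on `(t, y)` only.
Splitting with respect to the first derivatives of `f` (`MapsEquation.determining`) shows that `x̃`
does not depend on `u` and is the fractional linear function `(ỹ_t + x ỹ_y) / (t̃_t + x t̃_y)` of `x`,
that `|x|^β x̃_x² = |x̃|^β̃ (t̃_t + x t̃_y)`, and gives an equation for `ũ`.

*Solution.* The same `φ` serves all `β`. Comparison of two values of `β` gives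
`log |x| = k log |x̃|` with a constant `k`, and a fractional linear function satisfies this only for
`k = 1` or `k = -1` (`DeterminingEquations.exponent`). In the first case `t̃_t` is a power of `|x|`
that does not depend on `x`, hence `t̃_t = 1` and `β̃ = β`; in the second case the same reasoning for
`t̃_y` gives `β̃ = 5 - β`. The equation for `ũ` splits with respect to the powers of `|x|` and becomes
`V_xx = V_xu = V_uu = 0`, `V_t + x V_y = 0` with `V = ũ` or `V = x ũ`; its solutions are found in
`solve_linear_system`. All of this holds on the dense open part of the domain where `x`, `x̃` and
`|x| - 1` do not vanish; the identities between derivatives extend to the whole domain by continuity,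
and connectedness makes the integration constants global (`classify`).

*Converse.* That the two families map equations of the class to equations of the class is checked by
differentiating the relation between `f` and `g` twice (`mapsEquation_first`,
`mapsEquation_second`).
-/

namespace KolmogorovPower

/-! ### Second prolongation of a point transformation -/

lemma two_le_infty : (2 : ℕ∞ω) ≤ ∞ := WithTop.coe_le_coe.2 (le_top : (2 : ℕ∞) ≤ ⊤)

/-- The polynomial of degree two with 1-jet `(p.2, ℓ)` at the point `p.1` and Hessian `B`. -/
noncomputable def jetFun (p : Vars) (ℓ : Base →L[ℝ] ℝ) (B : Base →L[ℝ] Base →L[ℝ] ℝ)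
    (w : Base) : ℝ :=
  p.2 + ℓ (w - p.1) + 2⁻¹ * B (w - p.1) (w - p.1)

/-- The tangent vector to a graph with slope `ℓ` that lies over the vector `v` of the base. -/
def lift (ℓ : Base →L[ℝ] ℝ) : Base →L[ℝ] Vars := (ContinuousLinearMap.id ℝ Base).prod ℓ

@[simp] lemma lift_apply (ℓ : Base →L[ℝ] ℝ) (v : Base) : lift ℓ v = (v, ℓ v) := rfl

lemma jetFun_self (p : Vars) (ℓ : Base →L[ℝ] ℝ) (B : Base →L[ℝ] Base →L[ℝ] ℝ) :
    jetFun p ℓ B p.1 = p.2 := by simp [jetFun]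

lemma contDiff_jetFun (p : Vars) (ℓ : Base →L[ℝ] ℝ) (B : Base →L[ℝ] Base →L[ℝ] ℝ) :
    ContDiff ℝ ∞ (jetFun p ℓ B) := by
  unfold jetFun
  fun_prop

lemma fderiv_jetFun (p : Vars) (ℓ : Base →L[ℝ] ℝ) {B : Base →L[ℝ] Base →L[ℝ] ℝ}
    (hB : ∀ v w, B v w = B w v) (w : Base) :
    fderiv ℝ (jetFun p ℓ B) w = ℓ + B (w - p.1) := by
  have h1 : HasFDerivAt (fun w : Base => w - p.1) (ContinuousLinearMap.id ℝ Base) w :=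
    (hasFDerivAt_id w).sub_const _
  have h2 : HasFDerivAt (fun w : Base => B (w - p.1)) (B.comp (ContinuousLinearMap.id ℝ Base)) w :=
    B.hasFDerivAt.comp w h1
  have h3 := ((ℓ.hasFDerivAt.comp w h1).const_add p.2).add ((h2.clm_apply h1).const_mul 2⁻¹)
  have h4 : HasFDerivAt (jetFun p ℓ B) _ w := h3
  rw [h4.fderiv]
  refine ContinuousLinearMap.ext fun v => ?_
  have h5 := hB v (w - p.1)
  simp only [add_apply, smul_apply, ContinuousLinearMap.comp_id,
    ContinuousLinearMap.flip_apply, h5, smul_eq_mul]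
  ring

/-- The second derivative of `F` along a curve `c`, by the chain rule. -/
lemma hasDerivAt_fderiv_curve {E G : Type*} [NormedAddCommGroup E] [NormedSpace ℝ E]
    [NormedAddCommGroup G] [NormedSpace ℝ G] {F : E → G} {c c' : ℝ → E} {c'' : E} {s : ℝ}
    (hF : ContDiffAt ℝ 2 F (c s)) (hc : HasDerivAt c (c' s) s) (hc' : HasDerivAt c' c'' s) :
    HasDerivAt (fun r => fderiv ℝ F (c r) (c' r))
      (fderiv ℝ (fderiv ℝ F) (c s) (c' s) (c' s) + fderiv ℝ F (c s) c'') s := by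
  have h1 : DifferentiableAt ℝ (fderiv ℝ F) (c s) :=
    (hF.fderiv_right (m := 1) (by norm_num)).differentiableAt (by norm_num)
  exact (h1.hasFDerivAt.comp_hasDerivAt s hc).clm_apply hc'

lemma fderiv_fderiv_apply {E G : Type*} [NormedAddCommGroup E] [NormedSpace ℝ E]
    [NormedAddCommGroup G] [NormedSpace ℝ G] {F : E → G} {p : E} (hF : ContDiffAt ℝ 2 F p)
    (v w : E) : fderiv ℝ (fun q => fderiv ℝ F q v) p w = fderiv ℝ (fderiv ℝ F) p w v := by
  have h1 : DifferentiableAt ℝ (fderiv ℝ F) p :=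
    (hF.fderiv_right (m := 1) (by norm_num)).differentiableAt (by norm_num)
  rw [(h1.hasFDerivAt.clm_apply (hasFDerivAt_const v p)).fderiv]
  simp

/-- The second prolongation of a point transformation in the direction needed here: if the graph of
`f` is carried to that of `g` and `a` is the direction along the graph of `f` that corresponds to
the vector `e` of the target base, then this is the value of the Hessian of `g` on `e`. -/
lemma hessian_transform {φ : Vars → Vars} {f g : Base → ℝ} {z : Base}
    (hφ : ContDiffAt ℝ 2 φ (z, f z)) (hf : ContDiffAt ℝ 2 f z)
    (hg : ContDiffAt ℝ 2 g (φ (z, f z)).1)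
    (hfg : ∀ᶠ w in 𝓝 z, g (φ (w, f w)).1 = (φ (w, f w)).2) {a e : Base}
    (ha : (fderiv ℝ φ (z, f z) (a, fderiv ℝ f z a)).1 = e) :
    let b := fderiv ℝ (fderiv ℝ φ) (z, f z) (a, fderiv ℝ f z a) (a, fderiv ℝ f z a) +
      fderiv ℝ φ (z, f z) (0, fderiv ℝ (fderiv ℝ f) z a a)
    fderiv ℝ (fderiv ℝ g) (φ (z, f z)).1 e e = b.2 - fderiv ℝ g (φ (z, f z)).1 b.1 := by
  intro b
  have hl : ∀ s : ℝ, HasDerivAt (fun s : ℝ => z + s • a) a s := fun s => by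
    simpa using ((hasDerivAt_id s).smul_const a).const_add z
  have hl0 : Tendsto (fun s : ℝ => z + s • a) (𝓝 0) (𝓝 z) := by
    simpa using (hl 0).continuousAt.tendsto
  have hfd : ∀ᶠ w in 𝓝 z, DifferentiableAt ℝ f w := by
    filter_upwards [hf.eventually (by simp)] with w hw using hw.differentiableAt (by norm_num)
  have hφd : ∀ᶠ q in 𝓝 (z, f z), DifferentiableAt ℝ φ q := by
    filter_upwards [hφ.eventually (by simp)] with w hw using hw.differentiableAt (by norm_num)
  have hgd : ∀ᶠ q in 𝓝 (φ (z, f z)).1, DifferentiableAt ℝ g q := by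
    filter_upwards [hg.eventually (by simp)] with w hw using hw.differentiableAt (by norm_num)
  set c : ℝ → Vars := fun s => (z + s • a, f (z + s • a)) with hc
  set c' : ℝ → Vars := fun s => (a, fderiv ℝ f (z + s • a) a) with hc'
  have hc0 : c 0 = (z, f z) := by simp [hc]
  have hc'0 : c' 0 = (a, fderiv ℝ f z a) := by simp [hc']
  have hcd : ∀ᶠ s in 𝓝 (0 : ℝ), HasDerivAt c (c' s) s := by
    filter_upwards [hl0.eventually hfd] with s hs
    exact (hl s).prodMk (hs.hasFDerivAt.comp_hasDerivAt s (hl s))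
  have hc'd : HasDerivAt c' (0, fderiv ℝ (fderiv ℝ f) z a a) 0 := by
    refine (hasDerivAt_const _ a).prodMk ?_
    have := hasDerivAt_fderiv_curve (F := f) (c := fun s : ℝ => z + s • a) (c' := fun _ => a)
      (s := 0) (by simpa using hf) (hl 0) (hasDerivAt_const _ a)
    simpa using this
  have hct : Tendsto c (𝓝 0) (𝓝 (z, f z)) := by
    simpa [hc0] using hcd.self_of_nhds.continuousAt.tendsto
  have hZt : Tendsto (fun s => (φ (c s)).1) (𝓝 0) (𝓝 (φ (z, f z)).1) :=
    (continuous_fst.continuousAt.comp hφ.continuousAt).tendsto.comp hct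
  have hφc : ∀ᶠ s in 𝓝 (0 : ℝ), HasDerivAt (fun r => φ (c r)) (fderiv ℝ φ (c s) (c' s)) s := by
    filter_upwards [hcd, hct.eventually hφd] with s h1 h2
    exact h2.hasFDerivAt.comp_hasDerivAt s h1
  have hφ2 : HasDerivAt (fun s => fderiv ℝ φ (c s) (c' s)) b 0 := by
    have := hasDerivAt_fderiv_curve (F := φ) (by rw [hc0]; exact hφ) hcd.self_of_nhds hc'd
    simpa only [hc0, hc'0] using this
  have key : ∀ᶠ s in 𝓝 (0 : ℝ), (fderiv ℝ φ (c s) (c' s)).2 =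
      fderiv ℝ g (φ (c s)).1 (fderiv ℝ φ (c s) (c' s)).1 := by
    filter_upwards [hφc, hZt.eventually hgd, (hl0.eventually hfg).eventually_nhds]
      with s h1 h2 h3
    have h4 : HasDerivAt (fun r => (φ (c r)).2) _ s := h1.snd
    have h5 : HasDerivAt (fun r => g (φ (c r)).1) _ s :=
      h2.hasFDerivAt.comp_hasDerivAt s h1.fst
    exact h4.unique (h5.congr_of_eventuallyEq (h3.mono fun r hr => hr.symm))
  have hL : HasDerivAt (fun s => (fderiv ℝ φ (c s) (c' s)).2) b.2 0 := hφ2.snd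
  have hR := hasDerivAt_fderiv_curve (F := g) (c := fun s => (φ (c s)).1)
    (c' := fun s => (fderiv ℝ φ (c s) (c' s)).1) (s := 0) (by rw [hc0]; exact hg)
    hφc.self_of_nhds.fst hφ2.fst
  have := hL.unique (hR.congr_of_eventuallyEq key)
  simp only [hc0, hc'0, ha] at this
  rw [this]
  ring

/-- The invariance condition in terms of jets. If the tangent space with slope `ℓ` is mapped to the
tangent space of a graph, with slope `lam`, then for every Hessian `B` the quadratic polynomial with
the 2-jet `(ℓ, B)` has a transformed function, by the inverse function theorem. Here `b.2 - lam b.1`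
is the second derivative of this function with respect to `x̃`. -/
lemma MapsEquation.jet_iff {Ω : Set Vars} {φ : Vars → Vars} {β β' : ℝ}
    (h : MapsEquation Ω φ β β') {p : Vars} (hp : p ∈ Ω) (hφ : ContDiffAt ℝ ∞ φ p)
    (hx : p.1.2.1 ≠ 0) (hX : (φ p).1.2.1 ≠ 0) {ℓ : Base →L[ℝ] ℝ}
    (hℓ : ∀ v, (fderiv ℝ φ p (v, ℓ v)).1 = 0 → v = 0) :
    ∃ lam : Base →L[ℝ] ℝ, (∀ v, lam (fderiv ℝ φ p (v, ℓ v)).1 = (fderiv ℝ φ p (v, ℓ v)).2) ∧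
      ∀ a : Base, (fderiv ℝ φ p (a, ℓ a)).1 = (0, 1, 0) →
      ∀ B : Base →L[ℝ] Base →L[ℝ] ℝ, (∀ v w, B v w = B w v) →
      ∀ b, b = fderiv ℝ (fderiv ℝ φ) p (a, ℓ a) (a, ℓ a) + fderiv ℝ φ p (0, B a a) →
      (ℓ (1, 0, 0) + p.1.2.1 * ℓ (0, 0, 1) = |p.1.2.1| ^ β * B (0, 1, 0) (0, 1, 0) ↔
        lam (1, 0, 0) + (φ p).1.2.1 * lam (0, 0, 1) = |(φ p).1.2.1| ^ β' * (b.2 - lam b.1)) := by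
  set L : Base →L[ℝ] Base :=
    (ContinuousLinearMap.fst ℝ Base ℝ).comp ((fderiv ℝ φ p).comp (lift ℓ)) with hL
  have hLv : ∀ v, L v = (fderiv ℝ φ p (v, ℓ v)).1 := fun v => rfl
  have hinj : Function.Injective L :=
    (injective_iff_map_eq_zero L).2 fun v hv => hℓ v (by rw [← hLv, hv])
  set L' : Base ≃L[ℝ] Base :=
    (LinearEquiv.ofInjectiveEndo (L : Base →ₗ[ℝ] Base) hinj).toContinuousLinearEquiv with hL'
  have hLL' : (L' : Base →L[ℝ] Base) = L := ContinuousLinearMap.ext fun v => rfl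
  set U' : Base →L[ℝ] ℝ :=
    (ContinuousLinearMap.snd ℝ Base ℝ).comp ((fderiv ℝ φ p).comp (lift ℓ)) with hU'
  refine ⟨U'.comp (L'.symm : Base →L[ℝ] Base), ?_, ?_⟩
  · intro v
    rw [← hLv, ← hLL']
    simp [hU']
  intro a ha B hB b hb
  set f := jetFun p ℓ B with hf
  have hfz : f p.1 = p.2 := jetFun_self p ℓ B
  have hpf : (p.1, f p.1) = p := by rw [hfz]
  have hf1 : fderiv ℝ f p.1 = ℓ := by rw [hf, fderiv_jetFun p ℓ hB]; simp
  have hfS : ContDiff ℝ ∞ f := contDiff_jetFun p ℓ B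
  have hf2 : fderiv ℝ (fderiv ℝ f) p.1 = B := by
    have : fderiv ℝ f = fun w => ℓ + B (w - p.1) := funext fun w => fderiv_jetFun p ℓ hB w
    rw [this]
    have h1 : HasFDerivAt (fun w : Base => w - p.1) (ContinuousLinearMap.id ℝ Base) p.1 :=
      (hasFDerivAt_id _).sub_const _
    have h2 : HasFDerivAt (fun w : Base => ℓ + B (w - p.1)) _ p.1 :=
      (B.hasFDerivAt.comp p.1 h1).const_add ℓ
    rw [h2.fderiv]
    rfl
  have hgr : ContDiffAt ℝ ∞ (fun w => φ (w, f w)) p.1 :=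
    ContDiffAt.comp p.1 (g := φ) (f := fun w => (w, f w)) (by simpa only [hpf] using hφ)
      (contDiffAt_id.prodMk hfS.contDiffAt)
  have hgr' : HasFDerivAt (fun w => φ (w, f w)) ((fderiv ℝ φ p).comp (lift ℓ)) p.1 := by
    have h1 : HasFDerivAt (fun w => (w, f w)) (lift ℓ) p.1 := by
      have := (hfS.differentiable (by simp) p.1).hasFDerivAt
      rw [hf1] at this
      exact (hasFDerivAt_id _).prodMk this
    have h2 : HasFDerivAt φ (fderiv ℝ φ p) (p.1, f p.1) := by
      rw [hpf]; exact (hφ.differentiableAt (by simp)).hasFDerivAt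
    exact h2.comp p.1 h1
  have hZ : ContDiffAt ℝ ∞ (fun w => (φ (w, f w)).1) p.1 := hgr.fst
  have hZ' : HasFDerivAt (fun w => (φ (w, f w)).1) (L' : Base →L[ℝ] Base) p.1 := by
    rw [hLL']; exact hgr'.fst
  set inv := hZ.localInverse hZ' (by simp) with hinv
  have hinvS : ContDiffAt ℝ ∞ inv (φ p).1 := by
    have := hZ.to_localInverse hZ' (by simp)
    simpa only [hpf] using this
  have hst := hZ.hasStrictFDerivAt' hZ' (by simp)
  have hinvz : inv (φ p).1 = p.1 := by
    have := hst.localInverse_apply_image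
    simp only [hpf] at this
    exact this
  have hleft : ∀ᶠ w in 𝓝 p.1, inv (φ (w, f w)).1 = w := hst.eventually_left_inverse
  set g : Base → ℝ := fun w => (φ (inv w, f (inv w))).2 with hg
  have hgS : ContDiffAt ℝ ∞ g (φ p).1 :=
    ContDiffAt.comp (φ p).1 (g := fun w => (φ (w, f w)).2) (f := inv)
      (by rw [hinvz]; exact hgr.snd) hinvS
  have hg' : fderiv ℝ g (φ p).1 = U'.comp (L'.symm : Base →L[ℝ] Base) := by
    have h0 := hst.to_localInverse.hasFDerivAt
    simp only [hpf] at h0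
    have h1 : HasFDerivAt (fun w => (φ (w, f w)).2) U' (inv (φ p).1) := by
      rw [hinvz]; exact hgr'.snd
    exact (h1.comp (φ p).1 h0).fderiv
  have hfg : ∀ᶠ w in 𝓝 p.1, g (φ (w, f w)).1 = (φ (w, f w)).2 := by
    filter_upwards [hleft] with w hw
    simp only [hg, hw]
  have hle := two_le_infty
  have key := h p.1 f g (by rwa [hpf]) hx (by rwa [hpf]) (hfS.contDiffAt.of_le hle)
    (by rw [hpf]; exact hgS.of_le hle) hfg
  have hH := hessian_transform (φ := φ) (f := f) (g := g) (z := p.1) (a := a) (e := (0, 1, 0))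
    (by rw [hpf]; exact hφ.of_le hle) (hfS.contDiffAt.of_le hle)
    (by rw [hpf]; exact hgS.of_le hle) hfg (by rw [hpf, hf1]; exact ha)
  simp only [hpf, hf1, hf2, ← hb, hg'] at hH
  rw [hpf] at key
  unfold SatisfiesAt at key
  rw [fderiv_fderiv_apply (hfS.contDiffAt.of_le hle), hf1, hf2,
    fderiv_fderiv_apply (hgS.of_le hle), hg', hH] at key
  exact key

/-! ### Determining equations at a point -/

/-- The symmetric bilinear form with the given diagonal matrix. -/
noncomputable def diagForm (m₁ m₂ m₃ : ℝ) : Base →L[ℝ] Base →L[ℝ] ℝ :=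
  let t : Base →L[ℝ] ℝ := ContinuousLinearMap.fst ℝ ℝ (ℝ × ℝ)
  let x : Base →L[ℝ] ℝ :=
    (ContinuousLinearMap.fst ℝ ℝ ℝ).comp (ContinuousLinearMap.snd ℝ ℝ (ℝ × ℝ))
  let y : Base →L[ℝ] ℝ :=
    (ContinuousLinearMap.snd ℝ ℝ ℝ).comp (ContinuousLinearMap.snd ℝ ℝ (ℝ × ℝ))
  m₁ • t.smulRight t + m₂ • x.smulRight x + m₃ • y.smulRight y

@[simp] lemma diagForm_apply (m₁ m₂ m₃ : ℝ) (v w : Base) :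
    diagForm m₁ m₂ m₃ v w = m₁ * (v.1 * w.1) + m₂ * (v.2.1 * w.2.1) + m₃ * (v.2.2 * w.2.2) := by
  simp [diagForm]

/-- The linear form with the given coefficients. -/
noncomputable def linForm (l₁ l₂ l₃ : ℝ) : Base →L[ℝ] ℝ :=
  l₁ • ContinuousLinearMap.fst ℝ ℝ (ℝ × ℝ) +
  l₂ • (ContinuousLinearMap.fst ℝ ℝ ℝ).comp (ContinuousLinearMap.snd ℝ ℝ (ℝ × ℝ)) +
  l₃ • (ContinuousLinearMap.snd ℝ ℝ ℝ).comp (ContinuousLinearMap.snd ℝ ℝ (ℝ × ℝ))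

@[simp] lemma linForm_apply (l₁ l₂ l₃ : ℝ) (v : Base) :
    linForm l₁ l₂ l₃ v = l₁ * v.1 + l₂ * v.2.1 + l₃ * v.2.2 := by
  simp [linForm]

lemma map_vars {G : Type*} [AddCommGroup G] [Module ℝ G] [TopologicalSpace G]
    (A : Vars →L[ℝ] G) (t x y u : ℝ) :
    A ((t, x, y), u) = t • A ((1, 0, 0), 0) + x • A ((0, 1, 0), 0) + y • A ((0, 0, 1), 0) +
      u • A ((0, 0, 0), 1) := by
  simp only [← map_smul, ← map_add]
  congr 1
  simp

lemma map_base {G : Type*} [AddCommGroup G] [Module ℝ G] [TopologicalSpace G]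
    (A : Base →L[ℝ] G) (t x y : ℝ) :
    A (t, x, y) = t • A (1, 0, 0) + x • A (0, 1, 0) + y • A (0, 0, 1) := by
  simp only [← map_smul, ← map_add]
  congr 1
  simp

/-- The vertical component of the image of a vertical vector, taken modulo the tangent space of the
transformed graph, does not vanish. -/
lemma vertical_ne_zero {A : Vars →L[ℝ] Vars} (hA : ∀ v, A v = 0 → v = 0) {ℓ lam : Base →L[ℝ] ℝ}
    (hℓ : ∀ v, (A (v, ℓ v)).1 = 0 → v = 0) (hlam : ∀ v, lam (A (v, ℓ v)).1 = (A (v, ℓ v)).2) :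
    (A (0, 1)).2 - lam (A (0, 1)).1 ≠ 0 := by
  intro h0
  set L : Base →ₗ[ℝ] Base :=
    (((ContinuousLinearMap.fst ℝ Base ℝ).comp (A.comp (lift ℓ)) : Base →L[ℝ] Base) :
      Base →ₗ[ℝ] Base) with hL
  have hLv : ∀ v, L v = (A (v, ℓ v)).1 := fun v => rfl
  have hinj : Function.Injective L :=
    (injective_iff_map_eq_zero L).2 fun v hv => hℓ v (by rw [← hLv, hv])
  obtain ⟨v, hv⟩ := LinearMap.injective_iff_surjective.1 hinj (A (0, 1)).1
  rw [hLv] at hv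
  have h1 : A ((v, ℓ v) - (0, 1)) = 0 := by
    rw [map_sub]
    refine Prod.ext ?_ ?_
    · simp [hv]
    · have := hlam v
      rw [hv] at this
      simp only [Prod.snd_sub, Prod.snd_zero]
      linarith
  have h2 := hA _ h1
  have h3 : v = 0 := by simpa using congrArg Prod.fst h2
  have h4 := congrArg Prod.snd h2
  simp [h3] at h4

/-- The Hessian of the original function enters the transformed equation only through its value on
`a`, so this direction has to be that of `∂/∂x`. -/
lemma MapsEquation.direction {Ω : Set Vars} {φ : Vars → Vars} {β β' : ℝ}
    (h : MapsEquation Ω φ β β') {p : Vars} (hp : p ∈ Ω) (hφ : ContDiffAt ℝ ∞ φ p)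
    (hinj : ∀ v, fderiv ℝ φ p v = 0 → v = 0)
    (hx : p.1.2.1 ≠ 0) (hX : (φ p).1.2.1 ≠ 0) {ℓ : Base →L[ℝ] ℝ}
    (hℓ : ∀ v, (fderiv ℝ φ p (v, ℓ v)).1 = 0 → v = 0) {a : Base}
    (ha : (fderiv ℝ φ p (a, ℓ a)).1 = (0, 1, 0)) : a.1 = 0 ∧ a.2.2 = 0 := by
  obtain ⟨lam, hlam, H⟩ := h.jet_iff hp hφ hx hX hℓ
  have hW := vertical_ne_zero hinj hℓ hlam
  set W := (fderiv ℝ φ p (0, 1)).2 - lam (fderiv ℝ φ p (0, 1)).1 with hWd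
  have hC : |p.1.2.1| ^ β ≠ 0 := (Real.rpow_pos_of_pos (abs_pos.2 hx) _).ne'
  have hK : |(φ p).1.2.1| ^ β' ≠ 0 := (Real.rpow_pos_of_pos (abs_pos.2 hX) _).ne'
  set S := fderiv ℝ (fderiv ℝ φ) p (a, ℓ a) (a, ℓ a) with hS
  -- The value of `f_xx` for which the 2-jet satisfies the original equation.
  set c := (ℓ (1, 0, 0) + p.1.2.1 * ℓ (0, 0, 1)) / |p.1.2.1| ^ β with hc
  have key : ∀ m₁ m₃ : ℝ, lam (1, 0, 0) + (φ p).1.2.1 * lam (0, 0, 1) =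
      |(φ p).1.2.1| ^ β' * (S.2 - lam S.1 +
        (m₁ * (a.1 * a.1) + c * (a.2.1 * a.2.1) + m₃ * (a.2.2 * a.2.2)) * W) := by
    intro m₁ m₃
    have h1 := (H a ha (diagForm m₁ c m₃) (fun v w => by simp; ring) _ rfl).1
      (by simp [hc]; field_simp)
    rw [h1]
    have h2 : ∀ r : ℝ, fderiv ℝ φ p ((0 : Base), r) = r • fderiv ℝ φ p ((0 : Base), 1) := by
      intro r
      rw [← map_smul]
      simp
    rw [h2, ← hS]
    simp only [diagForm_apply, Prod.snd_add, Prod.fst_add, Prod.smul_fst, Prod.smul_snd, map_add,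
      map_smul, smul_eq_mul, hWd]
    ring
  have k0 := key 0 0
  have k1 := key 1 0
  have k2 := key 0 1
  constructor
  · have : |(φ p).1.2.1| ^ β' * W * (a.1 * a.1) = 0 := by linear_combination k0 - k1
    simpa [hK, hW] using this
  · have : |(φ p).1.2.1| ^ β' * W * (a.2.2 * a.2.2) = 0 := by linear_combination k0 - k2
    simpa [hK, hW] using this

/-- An injective linear map of the tangent space is surjective. -/
lemma surj_of_inj {A : Vars →L[ℝ] Vars} (hA : ∀ v, A v = 0 → v = 0) (w : Vars) :
    ∃ v, A v = w :=
  LinearMap.injective_iff_surjective.1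
    ((injective_iff_map_eq_zero (A : Vars →ₗ[ℝ] Vars)).2 fun v hv => hA v hv) w

/-- The components `t̃` and `ỹ` depend on `(t, y)` only. -/
lemma MapsEquation.first_order {Ω : Set Vars} {φ : Vars → Vars} {β β' : ℝ}
    (h : MapsEquation Ω φ β β') {p : Vars} (hp : p ∈ Ω) (hφ : ContDiffAt ℝ ∞ φ p)
    (hinj : ∀ v, fderiv ℝ φ p v = 0 → v = 0)
    (hx : p.1.2.1 ≠ 0) (hX : (φ p).1.2.1 ≠ 0) (r : ℝ) :
    (fderiv ℝ φ p ((0, 1, 0), r)).1.1 = 0 ∧ (fderiv ℝ φ p ((0, 1, 0), r)).1.2.2 = 0 := by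
  set A := fderiv ℝ φ p with hA
  obtain ⟨⟨⟨k₁, k₂, k₃⟩, k₄⟩, hk⟩ := surj_of_inj hinj ((0, 0, 0), 1)
  -- The kernel of the base part of `A` is spanned by `k`, so a slope is admissible as soon as the
  -- graph direction it defines does not contain `k`.
  have adm : ∀ ℓ : Base →L[ℝ] ℝ, ℓ (k₁, k₂, k₃) ≠ k₄ → ∀ v, (A (v, ℓ v)).1 = 0 → v = 0 := by
    intro ℓ hℓ v hv
    set c := (A (v, ℓ v)).2 with hc
    have h1 : A ((v, ℓ v) - c • ((k₁, k₂, k₃), k₄)) = 0 := by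
      rw [map_sub, map_smul, hk]
      refine Prod.ext ?_ ?_
      · simp only [Prod.fst_sub, hv, Prod.smul_fst, Prod.fst_zero]
        simp
      · simp [hc]
    have h2 := hinj _ h1
    have h3 : v = c • (k₁, k₂, k₃) := sub_eq_zero.1 (congrArg Prod.fst h2)
    have h4 : ℓ v = c * k₄ := sub_eq_zero.1 (congrArg Prod.snd h2)
    rw [h3, map_smul, smul_eq_mul] at h4
    have h5 : c * (ℓ (k₁, k₂, k₃) - k₄) = 0 := by linarith
    have h6 : c = 0 := by
      rcases mul_eq_zero.1 h5 with h | h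
      · exact h
      · exact absurd (sub_eq_zero.1 h) hℓ
    rw [h3, h6, zero_smul]
  have step : ∀ ℓ : Base →L[ℝ] ℝ, ℓ (k₁, k₂, k₃) ≠ k₄ →
      (A ((0, 1, 0), ℓ (0, 1, 0))).1.1 = 0 ∧ (A ((0, 1, 0), ℓ (0, 1, 0))).1.2.2 = 0 := by
    intro ℓ hℓ
    have hℓ' := adm ℓ hℓ
    set L : Base →ₗ[ℝ] Base :=
      (((ContinuousLinearMap.fst ℝ Base ℝ).comp (A.comp (lift ℓ)) : Base →L[ℝ] Base) :
        Base →ₗ[ℝ] Base) with hL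
    have hLv : ∀ v, L v = (A (v, ℓ v)).1 := fun v => rfl
    have hi : Function.Injective L :=
      (injective_iff_map_eq_zero L).2 fun v hv => hℓ' v (by rw [← hLv, hv])
    obtain ⟨⟨a₁, a₂, a₃⟩, ha⟩ := LinearMap.injective_iff_surjective.1 hi (0, 1, 0)
    obtain ⟨h1, h3⟩ := h.direction hp hφ hinj hx hX hℓ' (a := (a₁, a₂, a₃)) (by rw [← ha]; rfl)
    simp only at h1 h3
    subst h1 h3
    have h4 : ((0, a₂, 0) : Base) = a₂ • (0, 1, 0) := by simp
    rw [h4, map_smul, hLv] at ha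
    have ha2 : a₂ ≠ 0 := by
      rintro rfl
      simpa using congrArg (fun q : Base => q.2.1) ha
    have h5 := congrArg Prod.fst ha
    have h6 := congrArg (fun q : Base => q.2.2) ha
    simp only [Prod.smul_fst, Prod.smul_snd, smul_eq_mul, mul_eq_zero, ha2, false_or] at h5 h6
    exact ⟨h5, h6⟩
  -- Two admissible slopes in the direction of `x`.
  obtain ⟨r₁, r₂, hr, h₁, h₂⟩ : ∃ r₁ r₂ : ℝ, r₁ ≠ r₂ ∧
      ((A ((0, 1, 0), r₁)).1.1 = 0 ∧ (A ((0, 1, 0), r₁)).1.2.2 = 0) ∧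
      ((A ((0, 1, 0), r₂)).1.1 = 0 ∧ (A ((0, 1, 0), r₂)).1.2.2 = 0) := by
    have hs : ∀ l₁ l₂ l₃ : ℝ, l₁ * k₁ + l₂ * k₂ + l₃ * k₃ ≠ k₄ →
        (A ((0, 1, 0), l₂)).1.1 = 0 ∧ (A ((0, 1, 0), l₂)).1.2.2 = 0 := by
      intro l₁ l₂ l₃ hl
      simpa using step (linForm l₁ l₂ l₃) (by simpa using hl)
    by_cases hk1 : k₁ = 0
    · by_cases hk3 : k₃ = 0
      · by_cases hk2 : k₂ = 0
        · have hk4 : k₄ ≠ 0 := by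
            rintro rfl
            subst hk1 hk2 hk3
            have : A ((0, 0, 0), 0) = 0 := map_zero A
            rw [this] at hk
            simpa using congrArg Prod.snd hk
          exact ⟨0, 1, by norm_num, hs 0 0 0 (by simpa using hk4.symm),
            hs 0 1 0 (by simpa [hk2] using hk4.symm)⟩
        · refine ⟨(k₄ + 1) / k₂, (k₄ + 2) / k₂, ?_, hs 0 _ 0 ?_, hs 0 _ 0 ?_⟩
          · intro h
            field_simp at h
            linarith
          · field_simp
            linarith
          · field_simp
            linarith
      · refine ⟨0, 1, by norm_num, hs 0 0 ((k₄ + 1) / k₃) ?_, hs 0 1 ((k₄ - k₂ + 1) / k₃) ?_⟩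
        · field_simp
          linarith
        · field_simp
          linarith
    · refine ⟨0, 1, by norm_num, hs ((k₄ + 1) / k₁) 0 0 ?_, hs ((k₄ - k₂ + 1) / k₁) 1 0 ?_⟩
      · field_simp
        linarith
      · field_simp
        linarith
  have e : ∀ s : ℝ, A ((0, 1, 0), s) = A ((0, 1, 0), 0) + s • A ((0, 0, 0), 1) := by
    intro s
    rw [map_vars A 0 1 0 s]
    simp
  rw [e] at h₁ h₂ ⊢
  simp only [Prod.fst_add, Prod.snd_add, Prod.smul_fst, Prod.smul_snd, smul_eq_mul] at h₁ h₂ ⊢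
  have hT : (A ((0, 0, 0), 1)).1.1 = 0 := by
    have : (r₁ - r₂) * (A ((0, 0, 0), 1)).1.1 = 0 := by linear_combination h₁.1 - h₂.1
    simpa [sub_ne_zero.2 hr] using this
  have hY : (A ((0, 0, 0), 1)).1.2.2 = 0 := by
    have : (r₁ - r₂) * (A ((0, 0, 0), 1)).1.2.2 = 0 := by linear_combination h₁.2 - h₂.2
    simpa [sub_ne_zero.2 hr] using this
  rw [hT, mul_zero, add_zero] at h₁ ⊢
  rw [hY, mul_zero, add_zero] at h₁ ⊢
  exact h₁

section Pointwise

variable {Ω : Set Vars} {φ : Vars → Vars} {β β' : ℝ} {p : Vars}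
  {Tt Ty Xt Xx Xy Xu Yt Yy Ut Ux Uy Uu : ℝ} {X2 U2 : ℝ → ℝ}

/-- The minors of the Jacobian matrix of a transformation whose components `t̃` and `ỹ` depend on
`(t, y)` only. -/
lemma minors_ne_zero (hinj : ∀ v, fderiv ℝ φ p v = 0 → v = 0)
    (hA : ∀ a b c d, fderiv ℝ φ p ((a, b, c), d) = ((Tt * a + Ty * c,
      Xt * a + Xx * b + Xy * c + Xu * d, Yt * a + Yy * c), Ut * a + Ux * b + Uy * c + Uu * d)) :
    Tt * Yy - Ty * Yt ≠ 0 ∧ Xx * Uu - Xu * Ux ≠ 0 := by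
  obtain ⟨⟨⟨a₁, a₂, a₃⟩, a₄⟩, ha⟩ := surj_of_inj hinj ((1, 0, 0), 0)
  obtain ⟨⟨⟨b₁, b₂, b₃⟩, b₄⟩, hb⟩ := surj_of_inj hinj ((0, 0, 1), 0)
  have hδ : Tt * Yy - Ty * Yt ≠ 0 := by
    rw [hA] at ha hb
    simp only [Prod.mk.injEq] at ha hb
    obtain ⟨⟨h1, -, h2⟩, -⟩ := ha
    obtain ⟨⟨h3, -, h4⟩, -⟩ := hb
    intro h0
    have : (Tt * Yy - Ty * Yt) * (a₁ * b₃ - a₃ * b₁) = 1 := by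
      linear_combination (Yt * b₁ + Yy * b₃) * h1 - (Tt * b₁ + Ty * b₃) * h2 + h4
    rw [h0, zero_mul] at this
    exact zero_ne_one this
  refine ⟨hδ, fun h0 => ?_⟩
  have k1 : fderiv ℝ φ p ((0, Uu, 0), -Ux) = 0 := by
    rw [hA]
    refine Prod.ext (Prod.ext ?_ (Prod.ext ?_ ?_)) ?_ <;> simp <;> linarith
  have k2 : fderiv ℝ φ p ((0, -Xu, 0), Xx) = 0 := by
    rw [hA]
    refine Prod.ext (Prod.ext ?_ (Prod.ext ?_ ?_)) ?_ <;> simp <;> linarith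
  have k1 := hinj _ k1
  have k2 := hinj _ k2
  simp only [Prod.mk_eq_zero, neg_eq_zero, true_and, and_true] at k1 k2
  have k3 : fderiv ℝ φ p ((0, 1, 0), 0) = 0 := by
    rw [hA]
    simp [k1, k2]
  simpa using hinj _ k3

/-- The equation between 2-jets, split with respect to the free derivatives `f_t` and `f_y`. Here
`(vt, vy)` is the `(t, y)`-part of the direction on the graph that corresponds to
`∂/∂t̃ + x̃ ∂/∂ỹ`, and `G` is the derivative of the transformed function with respect to `x̃`. -/
lemma MapsEquation.split (h : MapsEquation Ω φ β β') (hp : p ∈ Ω) (hφ : ContDiffAt ℝ ∞ φ p)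
    (hinj : ∀ v, fderiv ℝ φ p v = 0 → v = 0) (hx : p.1.2.1 ≠ 0) (hX : (φ p).1.2.1 ≠ 0)
    (hA : ∀ a b c d, fderiv ℝ φ p ((a, b, c), d) = ((Tt * a + Ty * c,
      Xt * a + Xx * b + Xy * c + Xu * d, Yt * a + Yy * c), Ut * a + Ux * b + Uy * c + Uu * d))
    (hQ : ∀ r, fderiv ℝ (fderiv ℝ φ) p ((0, 1, 0), r) ((0, 1, 0), r) = ((0, X2 r, 0), U2 r))
    {r : ℝ} (hr : Xx + r * Xu ≠ 0) {vt vy : ℝ} (hv1 : Tt * vt + Ty * vy = 1)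
    (hv2 : Yt * vt + Yy * vy = (φ p).1.2.1) {G : ℝ} (hG : G * (Xx + r * Xu) = Ux + r * Uu) :
    vt * |p.1.2.1| ^ β * (Xx + r * Xu) ^ 2 = |(φ p).1.2.1| ^ β' ∧ vy = p.1.2.1 * vt ∧
      vt * (Ut - G * Xt) + vy * (Uy - G * Xy) = vt * |p.1.2.1| ^ β * (U2 r - G * X2 r) := by
  obtain ⟨hδ, hΔ⟩ := minors_ne_zero hinj hA
  set x := p.1.2.1 with hxd
  set X := (φ p).1.2.1 with hXd
  have hC : |x| ^ β ≠ 0 := (Real.rpow_pos_of_pos (abs_pos.2 hx) _).ne'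
  set C := |x| ^ β with hCd
  set K := |X| ^ β' with hKd
  set m := Xx + r * Xu with hm
  have hW : Uu - G * Xu ≠ 0 := by
    intro h0
    apply hΔ
    have : (Uu - G * Xu) * m = Xx * Uu - Xu * Ux := by
      linear_combination (-Xu) * hG
    rw [← this, h0, zero_mul]
  have key : ∀ l₁ l₃ : ℝ, m ^ 2 * (vt * (Ut - G * Xt) + vy * (Uy - G * Xy) +
      (l₁ * vt + l₃ * vy) * (Uu - G * Xu)) * C =
      K * (C * (U2 r - G * X2 r) + (l₁ + x * l₃) * (Uu - G * Xu)) := by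
    intro l₁ l₃
    have hℓ : ∀ v, (fderiv ℝ φ p (v, linForm l₁ r l₃ v)).1 = 0 → v = 0 := by
      rintro ⟨v₁, v₂, v₃⟩ hv
      rw [hA] at hv
      simp only [Prod.mk_eq_zero, linForm_apply] at hv
      obtain ⟨e1, e2, e3⟩ := hv
      have h1 : v₁ = 0 := by
        have : (Tt * Yy - Ty * Yt) * v₁ = 0 := by linear_combination Yy * e1 - Ty * e3
        simpa [hδ] using this
      have h3 : v₃ = 0 := by
        have : (Tt * Yy - Ty * Yt) * v₃ = 0 := by linear_combination Tt * e3 - Yt * e1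
        simpa [hδ] using this
      have h2 : v₂ = 0 := by
        have : m * v₂ = 0 := by
          rw [h1, h3] at e2
          linear_combination e2
        simpa [hr] using this
      simp [h1, h2, h3]
    obtain ⟨lam, hlam, H⟩ := h.jet_iff hp hφ hx hX hℓ
    -- The slope `lam` of the transformed graph, evaluated on the images of `∂/∂x` and `(vt, 0, vy)`.
    have hle : lam (0, 1, 0) = G := by
      have := hlam (0, 1, 0)
      rw [hA] at this
      simp only [linForm_apply] at this
      rw [map_base lam] at this
      simp only [smul_eq_mul] at this
      apply mul_right_cancel₀ hr
      rw [hG]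
      linear_combination this
    have hlv : lam (1, 0, 0) + X * lam (0, 0, 1) =
        vt * (Ut - G * Xt) + vy * (Uy - G * Xy) + (l₁ * vt + l₃ * vy) * (Uu - G * Xu) := by
      have := hlam (vt, 0, vy)
      rw [hA] at this
      simp only [linForm_apply] at this
      rw [hv1, hv2, map_base lam, hle] at this
      simp only [smul_eq_mul] at this
      linear_combination this
    have hB := (H (0, 1 / m, 0) (by
      rw [hA]
      simp only [linForm_apply, Prod.mk.injEq]
      refine ⟨by ring, ?_, by ring⟩
      field_simp
      rw [hm]
      ring) (diagForm 0 ((l₁ + x * l₃) / C) 0) (fun v w => by simp only [diagForm_apply]; ring)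
      _ rfl).1 (by
        simp only [linForm_apply, diagForm_apply, ← hxd, ← hCd]
        field_simp
        ring)
    have e1 : (((0, 1 / m, 0) : Base), linForm l₁ r l₃ (0, 1 / m, 0)) =
        (1 / m) • (((0, 1, 0) : Base), r) := by
      simp only [linForm_apply, Prod.smul_mk, smul_eq_mul]
      refine Prod.ext (by simp) ?_
      simp only
      ring
    rw [hlv, e1, map_smul, map_smul, smul_apply, hQ, show (0 : Base) = (0, 0, 0) from rfl,
      hA] at hB
    simp only [diagForm_apply, Prod.smul_mk, smul_eq_mul, Prod.mk_add_mk] at hB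
    rw [map_base lam, hle] at hB
    simp only [smul_eq_mul] at hB
    rw [hB]
    field_simp
    ring
  have k0 := key 0 0
  have k1 := key 1 0
  have k2 := key 0 1
  have e1 : vt * C * m ^ 2 = K := by
    apply mul_right_cancel₀ hW
    linear_combination k1 - k0
  have hm2 : m ^ 2 ≠ 0 := pow_ne_zero _ hr
  refine ⟨e1, ?_, ?_⟩
  · apply mul_right_cancel₀ hW
    apply mul_right_cancel₀ hm2
    apply mul_right_cancel₀ hC
    linear_combination k2 - k0 - x * (Uu - G * Xu) * e1
  · apply mul_right_cancel₀ hm2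
    apply mul_right_cancel₀ hC
    linear_combination k0 - C * (U2 r - G * X2 r) * e1

/-- The determining equations at a point where `t̃` and `ỹ` depend on `(t, y)` only. -/
lemma MapsEquation.determining (h : MapsEquation Ω φ β β') (hp : p ∈ Ω)
    (hφ : ContDiffAt ℝ ∞ φ p)
    (hinj : ∀ v, fderiv ℝ φ p v = 0 → v = 0) (hx : p.1.2.1 ≠ 0) (hX : (φ p).1.2.1 ≠ 0)
    (hA : ∀ a b c d, fderiv ℝ φ p ((a, b, c), d) = ((Tt * a + Ty * c,
      Xt * a + Xx * b + Xy * c + Xu * d, Yt * a + Yy * c), Ut * a + Ux * b + Uy * c + Uu * d))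
    (hQ : ∀ r, fderiv ℝ (fderiv ℝ φ) p ((0, 1, 0), r) ((0, 1, 0), r) = ((0, X2 r, 0), U2 r)) :
    Xu = 0 ∧ Xx ≠ 0 ∧ Tt + p.1.2.1 * Ty ≠ 0 ∧
      (φ p).1.2.1 * (Tt + p.1.2.1 * Ty) = Yt + p.1.2.1 * Yy ∧
      |p.1.2.1| ^ β * Xx ^ 2 = |(φ p).1.2.1| ^ β' * (Tt + p.1.2.1 * Ty) ∧
      ∀ r, Xx * (Ut + p.1.2.1 * Uy) - (Ux + r * Uu) * (Xt + p.1.2.1 * Xy) =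
        |p.1.2.1| ^ β * (Xx * U2 r - (Ux + r * Uu) * X2 r) := by
  obtain ⟨hδ, hΔ⟩ := minors_ne_zero hinj hA
  have hspl := fun (r : ℝ) (hr : Xx + r * Xu ≠ 0) (vt vy : ℝ) => h.split hp hφ hinj hx hX hA hQ hr
    (vt := vt) (vy := vy)
  set x := p.1.2.1 with hxd
  set X := (φ p).1.2.1 with hXd
  have hC : |x| ^ β ≠ 0 := (Real.rpow_pos_of_pos (abs_pos.2 hx) _).ne'
  have hK : |X| ^ β' ≠ 0 := (Real.rpow_pos_of_pos (abs_pos.2 hX) _).ne'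
  set C := |x| ^ β with hCd
  set K := |X| ^ β' with hKd
  obtain ⟨vt, vy, hv1, hv2⟩ : ∃ vt vy : ℝ, Tt * vt + Ty * vy = 1 ∧ Yt * vt + Yy * vy = X := by
    refine ⟨(Yy - X * Ty) / (Tt * Yy - Ty * Yt), (X * Tt - Yt) / (Tt * Yy - Ty * Yt), ?_, ?_⟩ <;>
    · rw [mul_div, mul_div, ← add_div, div_eq_iff hδ]
      ring
  have hsp := fun (r : ℝ) (hr : Xx + r * Xu ≠ 0) => hspl r hr vt vy hv1 hv2
    (G := (Ux + r * Uu) / (Xx + r * Xu)) (div_mul_cancel₀ _ hr)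
  -- The square of `Xx + r * Xu` takes only one value besides zero as `r` varies, whereas for
  -- `Xu ≠ 0` it takes the values `1` and `4`.
  have hXu : Xu = 0 := by
    by_contra h0
    have h1 := (hsp ((1 - Xx) / Xu) (by field_simp; norm_num)).1
    have h2 := (hsp ((2 - Xx) / Xu) (by field_simp; norm_num)).1
    have e1 : Xx + (1 - Xx) / Xu * Xu = 1 := by field_simp; ring
    have e2 : Xx + (2 - Xx) / Xu * Xu = 2 := by field_simp; ring
    rw [e1] at h1
    rw [e2] at h2
    apply hK
    linarith
  subst hXu
  have hXx : Xx ≠ 0 := by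
    rintro rfl
    simp at hΔ
  have hs := fun r : ℝ => hsp r (by simpa using hXx)
  simp only [mul_zero, add_zero] at hs
  obtain ⟨s1, s2, -⟩ := hs 0
  have hvt1 : vt * (Tt + x * Ty) = 1 := by
    rw [s2] at hv1
    linear_combination hv1
  have hD : Tt + x * Ty ≠ 0 := by
    intro h0
    rw [h0, mul_zero] at hvt1
    exact zero_ne_one hvt1
  have hvt0 : vt ≠ 0 := by
    intro h0
    rw [h0, zero_mul] at hvt1
    exact zero_ne_one hvt1
  refine ⟨rfl, hXx, hD, ?_, ?_, ?_⟩
  · rw [s2] at hv2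
    linear_combination (Yt + x * Yy) * hvt1 - (Tt + x * Ty) * hv2
  · linear_combination (Tt + x * Ty) * s1 - C * Xx ^ 2 * hvt1
  · intro r
    obtain ⟨-, -, s3⟩ := hs r
    rw [s2] at s3
    field_simp at s3
    linear_combination s3

end Pointwise

/-! ### Directional derivatives -/

/-- The derivative of `F` in the direction of the vector `e`. -/
noncomputable def pd (e : Vars) (F : Vars → ℝ) (p : Vars) : ℝ := fderiv ℝ F p e

/-- The direction of `∂/∂t`. -/
abbrev et : Vars := ((1, 0, 0), 0)

/-- The direction of `∂/∂x`. -/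
abbrev ex : Vars := ((0, 1, 0), 0)

/-- The direction of `∂/∂y`. -/
abbrev ey : Vars := ((0, 0, 1), 0)

/-- The direction of `∂/∂u`. -/
abbrev eu : Vars := ((0, 0, 0), 1)

/-- The coordinate `t`, as a linear form. -/
def tC : Vars →L[ℝ] ℝ :=
  (ContinuousLinearMap.fst ℝ ℝ (ℝ × ℝ)).comp (ContinuousLinearMap.fst ℝ Base ℝ)

/-- The coordinate `x`, as a linear form. -/
def xC : Vars →L[ℝ] ℝ :=
  ((ContinuousLinearMap.fst ℝ ℝ ℝ).comp (ContinuousLinearMap.snd ℝ ℝ (ℝ × ℝ))).comp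
    (ContinuousLinearMap.fst ℝ Base ℝ)

/-- The coordinate `y`, as a linear form. -/
def yC : Vars →L[ℝ] ℝ :=
  ((ContinuousLinearMap.snd ℝ ℝ ℝ).comp (ContinuousLinearMap.snd ℝ ℝ (ℝ × ℝ))).comp
    (ContinuousLinearMap.fst ℝ Base ℝ)

/-- The coordinate `u`, as a linear form. -/
def uC : Vars →L[ℝ] ℝ := ContinuousLinearMap.snd ℝ Base ℝ

lemma tC_apply (p : Vars) : tC p = p.1.1 := rfl
lemma xC_apply (p : Vars) : xC p = p.1.2.1 := rfl
lemma yC_apply (p : Vars) : yC p = p.1.2.2 := rfl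
lemma uC_apply (p : Vars) : uC p = p.2 := rfl

section Pd

variable {Ω : Set Vars} {F G : Vars → ℝ} {p : Vars} {e e' : Vars}

lemma diffAt (hΩ : IsOpen Ω) (hF : ContDiffOn ℝ ∞ F Ω) (hp : p ∈ Ω) : DifferentiableAt ℝ F p :=
  (hF.contDiffAt (hΩ.mem_nhds hp)).differentiableAt (by simp)

lemma contDiffOn_pd (hΩ : IsOpen Ω) (hF : ContDiffOn ℝ ∞ F Ω) (e : Vars) :
    ContDiffOn ℝ ∞ (pd e F) Ω :=
  (hF.fderiv_of_isOpen (m := ∞) hΩ (by simp)).clm_apply contDiffOn_const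

lemma pd_pd (hF : ContDiffAt ℝ ∞ F p) :
    pd e (pd e' F) p = fderiv ℝ (fderiv ℝ F) p e e' :=
  fderiv_fderiv_apply (hF.of_le two_le_infty) e' e

lemma pd_comm (hΩ : IsOpen Ω) (hF : ContDiffOn ℝ ∞ F Ω) (hp : p ∈ Ω) (e e' : Vars) :
    pd e (pd e' F) p = pd e' (pd e F) p := by
  have h := hF.contDiffAt (hΩ.mem_nhds hp)
  rw [pd_pd h, pd_pd h]
  exact h.isSymmSndFDerivAt (by simpa using two_le_infty) e e'

lemma pd_congr (hΩ : IsOpen Ω) (h : ∀ q ∈ Ω, F q = G q) (hp : p ∈ Ω) (e : Vars) :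
    pd e F p = pd e G p := by
  unfold pd
  rw [Filter.EventuallyEq.fderiv_eq (Filter.eventuallyEq_of_mem (hΩ.mem_nhds hp) h)]

lemma pd_eq_zero (hΩ : IsOpen Ω) {c : ℝ} (h : ∀ q ∈ Ω, F q = c) (hp : p ∈ Ω) (e : Vars) :
    pd e F p = 0 := by
  rw [pd_congr hΩ (G := fun _ => c) h hp]
  simp [pd]

lemma pd_x_mul (hF : DifferentiableAt ℝ F p) (e : Vars) :
    pd e (fun q => q.1.2.1 * F q) p = e.1.2.1 * F p + p.1.2.1 * pd e F p := by
  have h : HasFDerivAt (fun q => xC q * F q) _ p := xC.hasFDerivAt.mul hF.hasFDerivAt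
  have h' : fderiv ℝ (fun q : Vars => q.1.2.1 * F q) p = _ := h.fderiv
  unfold pd
  rw [h']
  simp [xC_apply]
  ring

lemma pd_add (hF : DifferentiableAt ℝ F p) (hG : DifferentiableAt ℝ G p) (e : Vars) :
    pd e (fun q => F q + G q) p = pd e F p + pd e G p := by
  unfold pd
  rw [(hF.hasFDerivAt.fun_add hG.hasFDerivAt).fderiv]
  rfl

lemma pd_sq (hF : DifferentiableAt ℝ F p) (e : Vars) :
    pd e (fun q => F q ^ 2) p = 2 * F p * pd e F p := by
  simp_rw [pow_two]
  unfold pd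
  rw [(hF.hasFDerivAt.fun_mul hF.hasFDerivAt).fderiv]
  simp
  ring

/-- The derivative in the direction `e` as derivative along a line. -/
lemma hasDerivAt_line (hF : DifferentiableAt ℝ F p) (e : Vars) :
    HasDerivAt (fun s : ℝ => F (p + s • e)) (pd e F p) 0 := by
  have h1 : HasDerivAt (fun s : ℝ => p + s • e) e 0 := by
    simpa using ((hasDerivAt_id (0 : ℝ)).smul_const e).const_add p
  have h2 : HasFDerivAt F (fderiv ℝ F p) (p + (0 : ℝ) • e) := by simpa using hF.hasFDerivAt
  exact h2.comp_hasDerivAt 0 h1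

lemma hasDerivAt_line_x (p : Vars) : HasDerivAt (fun s : ℝ => (p + s • ex).1.2.1) 1 0 := by
  have := hasDerivAt_line (F := xC) (p := p) xC.differentiableAt ex
  have e : pd ex xC p = 1 := by
    unfold pd
    rw [xC.fderiv]
    rfl
  rwa [e] at this

lemma eventually_line (hΩ : IsOpen Ω) (hp : p ∈ Ω) (e : Vars) :
    ∀ᶠ s : ℝ in 𝓝 0, p + s • e ∈ Ω := by
  have h1 : ContinuousAt (fun s : ℝ => p + s • e) 0 := by fun_prop
  exact h1.eventually_mem (hΩ.mem_nhds (by simpa using hp))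

/-- On a connected open set, functions with equal partial derivatives differ by a constant. -/
lemma exists_eq_add_const (hΩ : IsOpen Ω) (hc : IsConnected Ω) (hF : ContDiffOn ℝ ∞ F Ω)
    (hG : ContDiffOn ℝ ∞ G Ω) (ht : ∀ p ∈ Ω, pd et F p = pd et G p)
    (hx : ∀ p ∈ Ω, pd ex F p = pd ex G p) (hy : ∀ p ∈ Ω, pd ey F p = pd ey G p)
    (hu : ∀ p ∈ Ω, pd eu F p = pd eu G p) : ∃ c, ∀ p ∈ Ω, F p = G p + c := by
  have h0 : EqOn (fderiv ℝ (fun q => F q - G q)) 0 Ω := by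
    intro p hp
    have h1 : fderiv ℝ F p = fderiv ℝ G p := by
      refine ContinuousLinearMap.ext fun v => ?_
      obtain ⟨⟨a, b, c⟩, d⟩ := v
      rw [map_vars, map_vars (fderiv ℝ G p)]
      have h1 := ht p hp
      have h2 := hx p hp
      have h3 := hy p hp
      have h4 := hu p hp
      unfold pd at h1 h2 h3 h4
      rw [h1, h2, h3, h4]
    rw [((diffAt hΩ hF hp).hasFDerivAt.fun_sub (diffAt hΩ hG hp).hasFDerivAt).fderiv, h1, sub_self]
    rfl
  obtain ⟨c, hc⟩ := hΩ.exists_is_const_of_fderiv_eq_zero hc.isPreconnected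
    ((hF.sub hG).differentiableOn (by simp)) h0
  exact ⟨c, fun p hp => by linarith [hc p hp]⟩

lemma exists_eq_const (hΩ : IsOpen Ω) (hc : IsConnected Ω) (hF : ContDiffOn ℝ ∞ F Ω)
    (ht : ∀ p ∈ Ω, pd et F p = 0) (hx : ∀ p ∈ Ω, pd ex F p = 0) (hy : ∀ p ∈ Ω, pd ey F p = 0)
    (hu : ∀ p ∈ Ω, pd eu F p = 0) : ∃ c, ∀ p ∈ Ω, F p = c := by
  obtain ⟨c, hc⟩ := exists_eq_add_const (G := fun _ => 0) hΩ hc hF contDiffOn_const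
    (by simpa [pd] using ht) (by simpa [pd] using hx) (by simpa [pd] using hy)
    (by simpa [pd] using hu)
  exact ⟨c, fun p hp => by simpa using hc p hp⟩

/-- The derivatives of a function that is affine up to the term `c₃ t x`. -/
lemma pd_model (c₁ c₂ c₃ c₄ c₆ : ℝ) (p e : Vars) :
    pd e (fun q => c₁ * q.1.1 + c₂ * q.2 + c₃ * (q.1.1 * q.1.2.1) + c₄ * q.1.2.1 + c₆ * q.1.2.2) p
      = c₁ * e.1.1 + c₂ * e.2 + c₃ * (e.1.1 * p.1.2.1 + p.1.1 * e.1.2.1) + c₄ * e.1.2.1 +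
        c₆ * e.1.2.2 := by
  have h := ((((tC.hasFDerivAt (x := p)).const_mul c₁).fun_add
    ((uC.hasFDerivAt (x := p)).const_mul c₂)).fun_add
    (((tC.hasFDerivAt (x := p)).fun_mul (xC.hasFDerivAt (x := p))).const_mul c₃)).fun_add
    ((xC.hasFDerivAt (x := p)).const_mul c₄) |>.fun_add
    ((yC.hasFDerivAt (x := p)).const_mul c₆)
  have h' : fderiv ℝ (fun q : Vars => c₁ * q.1.1 + c₂ * q.2 + c₃ * (q.1.1 * q.1.2.1) +
    c₄ * q.1.2.1 + c₆ * q.1.2.2) p = _ := h.fderiv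
  unfold pd
  rw [h']
  simp [tC_apply, xC_apply, yC_apply, uC_apply]
  ring

lemma contDiff_model (c₁ c₂ c₃ c₄ c₆ : ℝ) : ContDiff ℝ ∞ (fun q : Vars =>
    c₁ * q.1.1 + c₂ * q.2 + c₃ * (q.1.1 * q.1.2.1) + c₄ * q.1.2.1 + c₆ * q.1.2.2) := by
  fun_prop

/-! ### The linear system for the dependent variable -/

/-- The common solutions of `V_xx = V_xu = V_uu = 0` and `V_t + x V_y = 0`. -/
lemma solve_linear_system (hΩ : IsOpen Ω) (hc : IsConnected Ω) {V : Vars → ℝ}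
    (hV : ContDiffOn ℝ ∞ V Ω)
    (hxx : ∀ p ∈ Ω, pd ex (pd ex V) p = 0) (hxu : ∀ p ∈ Ω, pd ex (pd eu V) p = 0)
    (huu : ∀ p ∈ Ω, pd eu (pd eu V) p = 0)
    (hty : ∀ p ∈ Ω, pd et V p + p.1.2.1 * pd ey V p = 0) :
    ∃ c₂ c₃ c₄ c₅ : ℝ, ∀ p ∈ Ω,
      V p = c₂ * p.2 + c₃ * (p.1.1 * p.1.2.1 - p.1.2.2) + c₄ * p.1.2.1 + c₅ := by
  have s1 := fun e => contDiffOn_pd hΩ hV e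
  have s2 := fun e e' => contDiffOn_pd hΩ (s1 e) e'
  have d1 := fun e {p} (hp : p ∈ Ω) => diffAt hΩ (s1 e) hp
  have d2 := fun e e' {p} (hp : p ∈ Ω) => diffAt hΩ (s2 e e') hp
  have dx : ∀ {F : Vars → ℝ} {p}, DifferentiableAt ℝ F p →
      DifferentiableAt ℝ (fun q : Vars => q.1.2.1 * F q) p := by
    intro F p hF
    exact xC.differentiableAt.mul hF
  have hD : ∀ e, ∀ p ∈ Ω, pd e (pd et V) p + (e.1.2.1 * pd ey V p + p.1.2.1 * pd e (pd ey V) p)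
      = 0 := by
    intro e p hp
    have := pd_eq_zero hΩ hty hp e
    rwa [pd_add (d1 et hp) (dx (d1 ey hp)), pd_x_mul (d1 ey hp)] at this
  have hDu : ∀ p ∈ Ω, pd eu (pd et V) p + p.1.2.1 * pd eu (pd ey V) p = 0 := by
    intro p hp
    simpa using hD eu p hp
  have hDx : ∀ p ∈ Ω, pd ex (pd et V) p + (pd ey V p + p.1.2.1 * pd ex (pd ey V) p) = 0 := by
    intro p hp
    simpa using hD ex p hp
  -- A third derivative vanishes if one of the second ones it comes from does.
  have third : ∀ e e' e'' : Vars, (∀ p ∈ Ω, pd e (pd e' V) p = 0) → ∀ p ∈ Ω,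
      pd e (pd e' (pd e'' V)) p = 0 := by
    intro e e' e'' h p hp
    rw [pd_congr hΩ (fun q hq => pd_comm hΩ hV hq e' e'') hp, pd_comm hΩ (s1 e') hp,
      pd_eq_zero hΩ h hp]
  have huy : ∀ p ∈ Ω, pd eu (pd ey V) p = 0 := by
    intro p hp
    -- The `x`-derivative of `V_tu + x V_yu = 0`.
    have h1 := pd_eq_zero hΩ hDu hp ex
    rw [pd_add (d2 et eu hp) (dx (d2 ey eu hp)), pd_x_mul (d2 ey eu hp), third ex eu et hxu p hp,
      third ex eu ey hxu p hp] at h1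
    simpa using h1
  have hut : ∀ p ∈ Ω, pd eu (pd et V) p = 0 := by
    intro p hp
    simpa [huy p hp] using hDu p hp
  have hxy : ∀ p ∈ Ω, pd ex (pd ey V) p = 0 := by
    intro p hp
    -- The `x`-derivative of `V_tx + V_y + x V_xy = 0`.
    have h1 := pd_eq_zero hΩ hDx hp ex
    rw [pd_add (d2 et ex hp) ((d1 ey hp).fun_add (dx (d2 ey ex hp))),
      pd_add (d1 ey hp) (dx (d2 ey ex hp)), pd_x_mul (d2 ey ex hp), third ex ex et hxx p hp,
      third ex ex ey hxx p hp] at h1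
    simp only [mul_zero, add_zero, zero_add, one_mul] at h1
    linarith
  have hxt : ∀ p ∈ Ω, pd ex (pd et V) p + pd ey V p = 0 := by
    intro p hp
    simpa [hxy p hp] using hDx p hp
  have hyy : ∀ p ∈ Ω, pd ey (pd ey V) p = 0 := by
    intro p hp
    have h1 := pd_eq_zero hΩ hxt hp ey
    rw [pd_add (d2 et ex hp) (d1 ey hp), third ey ex et
      (fun q hq => by rw [pd_comm hΩ hV hq, hxy q hq]) p hp] at h1
    simpa using h1
  have hyt : ∀ p ∈ Ω, pd ey (pd et V) p = 0 := by
    intro p hp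
    simpa [hyy p hp] using hD ey p hp
  obtain ⟨c₂, h2⟩ := exists_eq_const hΩ hc (s1 eu)
    (fun p hp => by rw [pd_comm hΩ hV hp, hut p hp]) hxu
    (fun p hp => by rw [pd_comm hΩ hV hp, huy p hp]) huu
  obtain ⟨k₃, h3⟩ := exists_eq_const hΩ hc (s1 ey)
    (fun p hp => by rw [pd_comm hΩ hV hp, hyt p hp]) hxy hyy huy
  obtain ⟨c₄, h4⟩ := exists_eq_add_const hΩ hc (s1 ex)
    (contDiff_model (-k₃) 0 0 0 0).contDiffOn
    (fun p hp => by
      rw [pd_model, pd_comm hΩ hV hp]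
      linarith [hxt p hp, h3 p hp])
    (fun p hp => by rw [pd_model, hxx p hp]; simp)
    (fun p hp => by rw [pd_model, pd_comm hΩ hV hp, hxy p hp]; simp)
    (fun p hp => by rw [pd_model, pd_comm hΩ hV hp, hxu p hp]; simp)
  obtain ⟨c₅, h5⟩ := exists_eq_add_const hΩ hc hV
    (contDiff_model 0 c₂ (-k₃) c₄ k₃).contDiffOn
    (fun p hp => by
      rw [pd_model]
      have := hty p hp
      rw [h3 p hp] at this
      simp only [mul_zero, add_zero, mul_one]
      linarith)
    (fun p hp => by
      rw [pd_model, h4 p hp]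
      simp)
    (fun p hp => by rw [pd_model, h3 p hp]; simp)
    (fun p hp => by rw [pd_model, h2 p hp]; simp)
  exact ⟨c₂, -k₃, c₄, c₅, fun p hp => by rw [h5 p hp]; ring⟩

end Pd

/-! ### Determining equations on an open set -/

/-- The component `t̃` of a point transformation. -/
def newT (φ : Vars → Vars) (p : Vars) : ℝ := (φ p).1.1

/-- The component `x̃` of a point transformation. -/
def newX (φ : Vars → Vars) (p : Vars) : ℝ := (φ p).1.2.1

/-- The component `ỹ` of a point transformation. -/
def newY (φ : Vars → Vars) (p : Vars) : ℝ := (φ p).1.2.2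

/-- The component `ũ` of a point transformation. -/
def newU (φ : Vars → Vars) (p : Vars) : ℝ := (φ p).2

section Components

variable {Ω : Set Vars} {φ : Vars → Vars} {p : Vars}

lemma contDiffOn_comps (hφ : ContDiffOn ℝ ∞ φ Ω) :
    ContDiffOn ℝ ∞ (newT φ) Ω ∧ ContDiffOn ℝ ∞ (newX φ) Ω ∧ ContDiffOn ℝ ∞ (newY φ) Ω ∧
      ContDiffOn ℝ ∞ (newU φ) Ω :=
  ⟨hφ.fst.fst, hφ.fst.snd.fst, hφ.fst.snd.snd, hφ.snd⟩

lemma pd_clm (π : Vars →L[ℝ] ℝ) (hφ : DifferentiableAt ℝ φ p) (e : Vars) :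
    pd e (fun q => π (φ q)) p = π (fderiv ℝ φ p e) := by
  have h : HasFDerivAt (fun q => π (φ q)) _ p := π.hasFDerivAt.comp p hφ.hasFDerivAt
  unfold pd
  rw [h.fderiv]
  rfl

lemma pd_pd_clm (π : Vars →L[ℝ] ℝ) (hφ : ContDiffAt ℝ ∞ φ p) (e e' : Vars) :
    pd e (pd e' (fun q => π (φ q))) p = π (fderiv ℝ (fderiv ℝ φ) p e e') := by
  rw [← fderiv_fderiv_apply (hφ.of_le two_le_infty)]
  have h1 : pd e' (fun q => π (φ q)) =ᶠ[𝓝 p] fun q => π (fderiv ℝ φ q e') := by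
    filter_upwards [(hφ.of_le two_le_infty).eventually (by simp)] with q hq
    exact pd_clm π (hq.differentiableAt (by norm_num)) e'
  have h2 : DifferentiableAt ℝ (fun q => fderiv ℝ φ q e') p := by
    have h1 : DifferentiableAt ℝ (fderiv ℝ φ) p :=
      (hφ.fderiv_right (m := 1) two_le_infty).differentiableAt (by norm_num)
    exact h1.clm_apply (differentiableAt_const _)
  rw [← pd_clm π h2]
  exact congrArg (fun A : Vars →L[ℝ] ℝ => A e) h1.fderiv_eq

lemma fderiv_eq_comps (hφ : DifferentiableAt ℝ φ p) (e : Vars) :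
    fderiv ℝ φ p e = ((pd e (newT φ) p, pd e (newX φ) p, pd e (newY φ) p), pd e (newU φ) p) := by
  refine Prod.ext (Prod.ext ?_ (Prod.ext ?_ ?_)) ?_
  · exact (pd_clm tC hφ e).symm
  · exact (pd_clm xC hφ e).symm
  · exact (pd_clm yC hφ e).symm
  · exact (pd_clm uC hφ e).symm

lemma fderiv_fderiv_eq_comps (hφ : ContDiffAt ℝ ∞ φ p) (e e' : Vars) :
    fderiv ℝ (fderiv ℝ φ) p e e' = ((pd e (pd e' (newT φ)) p, pd e (pd e' (newX φ)) p,
      pd e (pd e' (newY φ)) p), pd e (pd e' (newU φ)) p) := by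
  refine Prod.ext (Prod.ext ?_ (Prod.ext ?_ ?_)) ?_
  · exact (pd_pd_clm tC hφ e e').symm
  · exact (pd_pd_clm xC hφ e e').symm
  · exact (pd_pd_clm yC hφ e e').symm
  · exact (pd_pd_clm uC hφ e e').symm

end Components

/-- The determining equations for the transformations `φ` that map, on the open set `Ω`, for every
`β` the equation with parameter `β` to the equation with parameter `b β`. -/
structure DeterminingEquations (Ω : Set Vars) (φ : Vars → Vars) (b : ℝ → ℝ) : Prop where
  T_x : ∀ p ∈ Ω, pd ex (newT φ) p = 0
  T_u : ∀ p ∈ Ω, pd eu (newT φ) p = 0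
  Y_x : ∀ p ∈ Ω, pd ex (newY φ) p = 0
  Y_u : ∀ p ∈ Ω, pd eu (newY φ) p = 0
  X_u : ∀ p ∈ Ω, pd eu (newX φ) p = 0
  X_x : ∀ p ∈ Ω, pd ex (newX φ) p ≠ 0
  minor : ∀ p ∈ Ω, pd et (newT φ) p * pd ey (newY φ) p - pd ey (newT φ) p * pd et (newY φ) p ≠ 0
  denom : ∀ p ∈ Ω, pd et (newT φ) p + p.1.2.1 * pd ey (newT φ) p ≠ 0
  moebius : ∀ p ∈ Ω, newX φ p * (pd et (newT φ) p + p.1.2.1 * pd ey (newT φ) p) =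
    pd et (newY φ) p + p.1.2.1 * pd ey (newY φ) p
  coeff : ∀ p ∈ Ω, ∀ β : ℝ, |p.1.2.1| ^ β * pd ex (newX φ) p ^ 2 =
    |newX φ p| ^ b β * (pd et (newT φ) p + p.1.2.1 * pd ey (newT φ) p)
  potential : ∀ p ∈ Ω, ∀ β r : ℝ, pd ex (newX φ) p * (pd et (newU φ) p + p.1.2.1 * pd ey (newU φ) p) -
      (pd ex (newU φ) p + r * pd eu (newU φ) p) *
        (pd et (newX φ) p + p.1.2.1 * pd ey (newX φ) p) =
    |p.1.2.1| ^ β * (pd ex (newX φ) p * (pd ex (pd ex (newU φ)) p +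
      2 * r * pd ex (pd eu (newU φ)) p + r ^ 2 * pd eu (pd eu (newU φ)) p) -
      (pd ex (newU φ) p + r * pd eu (newU φ) p) * (pd ex (pd ex (newX φ)) p +
      2 * r * pd ex (pd eu (newX φ)) p + r ^ 2 * pd eu (pd eu (newX φ)) p))

/-- Where `x` and `x̃` do not vanish, transformations that map all equations of the class to
equations of the class satisfy the determining equations. -/
lemma determiningEquations {Ω Ω' : Set Vars} {φ : Vars → Vars} {b : ℝ → ℝ} (hΩ' : IsOpen Ω')
    (hsub : Ω' ⊆ Ω) (hφ : ContDiffOn ℝ ∞ φ Ω')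
    (hinj : ∀ p ∈ Ω', ∀ v, fderiv ℝ φ p v = 0 → v = 0)
    (hx : ∀ p ∈ Ω', p.1.2.1 ≠ 0) (hX : ∀ p ∈ Ω', newX φ p ≠ 0)
    (h : ∀ β, MapsEquation Ω φ β (b β)) : DeterminingEquations Ω' φ b := by
  have hs : ∀ p ∈ Ω', ContDiffAt ℝ ∞ φ p := fun p hp => hφ.contDiffAt (hΩ'.mem_nhds hp)
  have hd : ∀ p ∈ Ω', DifferentiableAt ℝ φ p := fun p hp => (hs p hp).differentiableAt (by simp)
  obtain ⟨sT, sX, sY, sU⟩ := contDiffOn_comps hφ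
  have h1 : ∀ p ∈ Ω', ∀ r, pd ((0, 1, 0), r) (newT φ) p = 0 ∧
      pd ((0, 1, 0), r) (newY φ) p = 0 := by
    intro p hp r
    have := (h 0).first_order (hsub hp) (hs p hp) (hinj p hp) (hx p hp) (hX p hp) r
    rwa [fderiv_eq_comps (hd p hp)] at this
  have split1 : ∀ (F : Vars → ℝ) (p : Vars) (a b c d : ℝ), pd ((a, b, c), d) F p =
      a * pd et F p + b * pd ex F p + c * pd ey F p + d * pd eu F p := by
    intro F p a b c d
    exact map_vars (fderiv ℝ F p) a b c d
  have hu : ∀ F : Vars → ℝ, (∀ p ∈ Ω', ∀ r, pd ((0, 1, 0), r) F p = 0) →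
      ∀ p ∈ Ω', pd eu F p = 0 := by
    intro F hF p hp
    have e1 := hF p hp 1
    have e0 := hF p hp 0
    rw [split1] at e1 e0
    linarith
  have Tu := hu _ fun p hp r => (h1 p hp r).1
  have Yu := hu _ fun p hp r => (h1 p hp r).2
  have Tx : ∀ p ∈ Ω', pd ex (newT φ) p = 0 := fun p hp => (h1 p hp 0).1
  have Yx : ∀ p ∈ Ω', pd ex (newY φ) p = 0 := fun p hp => (h1 p hp 0).2
  have split2 : ∀ F : Vars → ℝ, ContDiffOn ℝ ∞ F Ω' → ∀ p ∈ Ω', ∀ r,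
      pd ((0, 1, 0), r) (pd ((0, 1, 0), r) F) p =
        pd ex (pd ex F) p + 2 * r * pd ex (pd eu F) p + r ^ 2 * pd eu (pd eu F) p := by
    intro F hF p hp r
    have hp' := hF.contDiffAt (hΩ'.mem_nhds hp)
    have hc := pd_comm hΩ' hF hp eu ex
    rw [pd_pd hp', pd_pd hp'] at hc
    rw [pd_pd hp', pd_pd hp', pd_pd hp', pd_pd hp']
    have e1 : (((0, 1, 0), r) : Vars) = ex + r • eu := by simp
    rw [e1]
    simp only [map_add, map_smul, add_apply, smul_apply, smul_eq_mul, hc]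
    ring
  have hA : ∀ p ∈ Ω', ∀ a b c d, fderiv ℝ φ p ((a, b, c), d) =
      ((pd et (newT φ) p * a + pd ey (newT φ) p * c, pd et (newX φ) p * a + pd ex (newX φ) p * b +
        pd ey (newX φ) p * c + pd eu (newX φ) p * d,
        pd et (newY φ) p * a + pd ey (newY φ) p * c),
        pd et (newU φ) p * a + pd ex (newU φ) p * b + pd ey (newU φ) p * c +
          pd eu (newU φ) p * d) := by
    intro p hp a b c d
    rw [fderiv_eq_comps (hd p hp)]
    simp only [split1 _ p a b c d, Tx p hp, Tu p hp, Yx p hp, Yu p hp]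
    refine Prod.ext (Prod.ext ?_ (Prod.ext ?_ ?_)) ?_ <;> simp only <;> ring
  have hQ : ∀ p ∈ Ω', ∀ r, fderiv ℝ (fderiv ℝ φ) p ((0, 1, 0), r) ((0, 1, 0), r) =
      ((0, pd ex (pd ex (newX φ)) p +
      2 * r * pd ex (pd eu (newX φ)) p + r ^ 2 * pd eu (pd eu (newX φ)) p, 0),
      pd ex (pd ex (newU φ)) p +
      2 * r * pd ex (pd eu (newU φ)) p + r ^ 2 * pd eu (pd eu (newU φ)) p) := by
    intro p hp r
    rw [fderiv_fderiv_eq_comps (hs p hp), split2 _ sX p hp, split2 _ sU p hp,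
      pd_eq_zero hΩ' (fun q hq => (h1 q hq r).1) hp, pd_eq_zero hΩ' (fun q hq => (h1 q hq r).2) hp]
  have key := fun β p (hp : p ∈ Ω') => (h β).determining (hsub hp) (hs p hp) (hinj p hp)
    (hx p hp) (hX p hp) (hA p hp) (hQ p hp)
  exact
    { T_x := Tx
      T_u := Tu
      Y_x := Yx
      Y_u := Yu
      X_u := fun p hp => (key 0 p hp).1
      X_x := fun p hp => (key 0 p hp).2.1
      minor := fun p hp => (minors_ne_zero (hinj p hp) (hA p hp)).1
      denom := fun p hp => (key 0 p hp).2.2.1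
      moebius := fun p hp => (key 0 p hp).2.2.2.1
      coeff := fun p hp β => (key β p hp).2.2.2.2.1
      potential := fun p hp β r => (key β p hp).2.2.2.2.2 r }

/-! ### The components for the independent variables -/

section Solve

variable {Ω : Set Vars} {φ : Vars → Vars} {b : ℝ → ℝ}

/-- If `log |x|` is proportional to `log |x̃|`, then the fractional linear function `x̃` of `x` is
proportional to `x` or to `1 / x`. -/
lemma DeterminingEquations.exponent (H : DeterminingEquations Ω φ b) (hΩ : IsOpen Ω)
    (hφ : ContDiffOn ℝ ∞ φ Ω) (hx : ∀ p ∈ Ω, p.1.2.1 ≠ 0) (hX : ∀ p ∈ Ω, newX φ p ≠ 0)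
    {p : Vars} (hp : p ∈ Ω) :
    |p.1.2.1| = |newX φ p| ^ (b 1 - b 0) ∧
    ((b 1 - b 0 = 1 ∧ pd ey (newT φ) p = 0 ∧ pd et (newY φ) p = 0 ∧
      newX φ p = p.1.2.1 * pd ex (newX φ) p) ∨
     (b 1 - b 0 = -1 ∧ pd et (newT φ) p = 0 ∧ pd ey (newY φ) p = 0 ∧
      newX φ p = -(p.1.2.1 * pd ex (newX φ) p))) := by
  obtain ⟨sT, sX, sY, sU⟩ := contDiffOn_comps hφ
  set k := b 1 - b 0 with hk
  have hpow : ∀ q ∈ Ω, |q.1.2.1| = |newX φ q| ^ k := by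
    intro q hq
    have h0 := H.coeff q hq 0
    have h1 := H.coeff q hq 1
    rw [Real.rpow_zero, one_mul] at h0
    rw [Real.rpow_one, h0] at h1
    have hXp := abs_pos.2 (hX q hq)
    rw [hk, Real.rpow_sub hXp, eq_div_iff (Real.rpow_pos_of_pos hXp _).ne']
    apply mul_right_cancel₀ (H.denom q hq)
    linear_combination h1
  have hlog : ∀ q ∈ Ω, Real.log q.1.2.1 = k * Real.log (newX φ q) := by
    intro q hq
    rw [← Real.log_abs, hpow q hq, Real.log_rpow (abs_pos.2 (hX q hq)), Real.log_abs]
  have lx := hasDerivAt_line_x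
  have l0 : ∀ q : Vars, q + (0 : ℝ) • ex = q := fun q => by simp
  -- The logarithmic derivative with respect to `x`.
  have hXx : ∀ q ∈ Ω, newX φ q = k * q.1.2.1 * pd ex (newX φ) q := by
    intro q hq
    have h1 := (lx q).log (by rw [l0]; exact hx q hq)
    have h2 := ((hasDerivAt_line (diffAt hΩ sX hq) ex).log (by rw [l0]; exact hX q hq)).const_mul k
    have h3 := h1.unique (h2.congr_of_eventuallyEq
      ((eventually_line hΩ hq ex).mono fun s hs => hlog _ hs))
    simp only [l0] at h3
    have h4 := hx q hq
    have h5 := hX q hq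
    field_simp at h3
    linarith
  have lconst : ∀ F : Vars → ℝ, ContDiffOn ℝ ∞ F Ω → (∀ q ∈ Ω, pd ex F q = 0) → ∀ e, ∀ q ∈ Ω,
      HasDerivAt (fun s : ℝ => pd e F (q + s • ex)) 0 0 := by
    intro F hF h0 e q hq
    have := hasDerivAt_line (diffAt hΩ (contDiffOn_pd hΩ hF e) hq) ex
    rwa [pd_comm hΩ hF hq, pd_eq_zero hΩ h0 hq] at this
  have Tt := lconst _ sT H.T_x et
  have Ty := lconst _ sT H.T_x ey
  have Yt := lconst _ sY H.Y_x et
  have Yy := lconst _ sY H.Y_x ey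
  have hzero : ∀ {f : ℝ → ℝ} {f' : ℝ} {F : Vars → ℝ} {q : Vars}, q ∈ Ω → (∀ r ∈ Ω, F r = 0) →
      HasDerivAt f f' 0 → (∀ s : ℝ, f s = F (q + s • ex)) → f' = 0 := by
    intro f f' F q hq hF hf hfF
    refine hf.unique ((hasDerivAt_const (0 : ℝ) (0 : ℝ)).congr_of_eventuallyEq ?_)
    filter_upwards [eventually_line hΩ hq ex] with s hs
    rw [hfF, hF _ hs]
  -- The derivative of the fractional linear relation.
  have hmob' : ∀ q ∈ Ω, pd ex (newX φ) q * (pd et (newT φ) q + q.1.2.1 * pd ey (newT φ) q) +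
      newX φ q * pd ey (newT φ) q - pd ey (newY φ) q = 0 := by
    intro q hq
    have h1 := (((hasDerivAt_line (diffAt hΩ sX hq) ex).fun_mul
      ((Tt q hq).fun_add ((lx q).fun_mul (Ty q hq)))).fun_sub
      ((Yt q hq).fun_add ((lx q).fun_mul (Yy q hq))))
    have h2 := hzero (F := fun q => newX φ q * (pd et (newT φ) q + q.1.2.1 * pd ey (newT φ) q) -
      (pd et (newY φ) q + q.1.2.1 * pd ey (newY φ) q)) hq
      (fun r hr => sub_eq_zero.2 (H.moebius r hr)) h1 (fun s => rfl)
    simp only [l0] at h2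
    linarith
  -- The fractional linear relation and the logarithmic derivative combine to a polynomial identity
  -- in `x`, in which `t̃_t`, `t̃_y`, `ỹ_t`, `ỹ_y` do not depend on `x`; its coefficients are
  -- separated by differentiating it twice.
  have hquad : ∀ q ∈ Ω, (pd et (newY φ) q + q.1.2.1 * pd ey (newY φ) q) *
      (pd et (newT φ) q + q.1.2.1 * pd ey (newT φ) q) - k * q.1.2.1 *
      (pd et (newT φ) q * pd ey (newY φ) q - pd ey (newT φ) q * pd et (newY φ) q) = 0 := by
    intro q hq
    have h1 := hXx q hq
    have h2 := hmob' q hq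
    have h3 := H.moebius q hq
    set D := pd et (newT φ) q + q.1.2.1 * pd ey (newT φ) q with hD
    linear_combination (-D - k * q.1.2.1 * pd ey (newT φ) q) * h3 + D ^ 2 * h1 +
      k * q.1.2.1 * D * h2 + k * q.1.2.1 * pd ey (newY φ) q * hD
  have hquad' : ∀ q ∈ Ω, pd ey (newY φ) q * (pd et (newT φ) q + q.1.2.1 * pd ey (newT φ) q) +
      (pd et (newY φ) q + q.1.2.1 * pd ey (newY φ) q) * pd ey (newT φ) q - k *
      (pd et (newT φ) q * pd ey (newY φ) q - pd ey (newT φ) q * pd et (newY φ) q) = 0 := by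
    intro q hq
    have h1 := ((((Yt q hq).fun_add ((lx q).fun_mul (Yy q hq))).fun_mul
      ((Tt q hq).fun_add ((lx q).fun_mul (Ty q hq)))).fun_sub (((lx q).const_mul k).fun_mul
      (((Tt q hq).fun_mul (Yy q hq)).fun_sub ((Ty q hq).fun_mul (Yt q hq)))))
    have h2 := hzero hq hquad h1 (fun s => rfl)
    simp only [l0] at h2
    linear_combination h2
  have hquad'' : pd ey (newY φ) p * pd ey (newT φ) p = 0 := by
    have h1 := ((((Yy p hp).fun_mul ((Tt p hp).fun_add ((lx p).fun_mul (Ty p hp)))).fun_add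
      (((Yt p hp).fun_add ((lx p).fun_mul (Yy p hp))).fun_mul (Ty p hp))).fun_sub
      ((((Tt p hp).fun_mul (Yy p hp)).fun_sub ((Ty p hp).fun_mul (Yt p hp))).const_mul k))
    have h2 := hzero hp hquad' h1 (fun s => rfl)
    simp only [l0] at h2
    linear_combination h2 / 2
  refine ⟨hpow p hp, ?_⟩
  have q0 := hquad p hp
  have q1 := hquad' p hp
  have q2 := hXx p hp
  have hδ := H.minor p hp
  have hprod : pd et (newY φ) p * pd et (newT φ) p = 0 := by
    linear_combination q0 - p.1.2.1 * q1 + p.1.2.1 ^ 2 * hquad''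
  rcases mul_eq_zero.1 hquad'' with h0 | h0
  · rw [h0] at q1 hδ
    have hTy : pd ey (newT φ) p ≠ 0 := by
      intro h; rw [h] at hδ; simp at hδ
    have hYt : pd et (newY φ) p ≠ 0 := by
      intro h; rw [h] at hδ; simp at hδ
    have hk1 : k = -1 := by
      apply mul_right_cancel₀ (mul_ne_zero hTy hYt)
      linear_combination q1
    refine Or.inr ⟨hk1, by simpa [hYt] using hprod, h0, ?_⟩
    rw [q2, hk1]
    ring
  · rw [h0] at q1 hδ
    have hTt : pd et (newT φ) p ≠ 0 := by
      intro h; rw [h] at hδ; simp at hδ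
    have hYy : pd ey (newY φ) p ≠ 0 := by
      intro h; rw [h] at hδ; simp at hδ
    have hk1 : k = 1 := by
      apply mul_right_cancel₀ (mul_ne_zero hTt hYy)
      linear_combination -q1
    refine Or.inl ⟨hk1, h0, by simpa [hTt] using hprod, ?_⟩
    rw [q2, hk1]
    ring

/-- If `F` does not depend on `x` and equals a power of `|x|`, then it equals one. -/
lemma eq_one_of_eq_rpow (hΩ : IsOpen Ω) {F : Vars → ℝ} (hF : ContDiffOn ℝ ∞ F Ω)
    (hx : ∀ p ∈ Ω, p.1.2.1 ≠ 0) (h0 : ∀ p ∈ Ω, pd ex F p = 0) {r : ℝ}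
    (h : ∀ p ∈ Ω, F p = |p.1.2.1| ^ r) {p : Vars} (hp : p ∈ Ω) : r = 0 ∧ F p = 1 := by
  have hF0 : ∀ q ∈ Ω, F q ≠ 0 := fun q hq => by
    rw [h q hq]; exact (Real.rpow_pos_of_pos (abs_pos.2 (hx q hq)) _).ne'
  have hlog : ∀ q ∈ Ω, Real.log (F q) = r * Real.log q.1.2.1 := by
    intro q hq
    rw [h q hq, Real.log_rpow (abs_pos.2 (hx q hq)), Real.log_abs]
  have l0 : p + (0 : ℝ) • ex = p := by simp
  have h1 := (hasDerivAt_line (diffAt hΩ hF hp) ex).log (by rw [l0]; exact hF0 p hp)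
  have h2 := ((hasDerivAt_line_x p).log (by rw [l0]; exact hx p hp)).const_mul r
  have h3 := h1.unique (h2.congr_of_eventuallyEq
    ((eventually_line hΩ hp ex).mono fun s hs => hlog _ hs))
  rw [h0 p hp] at h3
  simp only [l0] at h3
  have hr : r = 0 := by
    have := hx p hp
    simpa [this] using h3.symm
  refine ⟨hr, ?_⟩
  rw [h p hp, hr, Real.rpow_zero]

/-- The case `|x̃| = |x|`: the equation for the coefficients says that `t̃_t` is a power of `|x|`. -/
lemma DeterminingEquations.first_case (H : DeterminingEquations Ω φ b) (hΩ : IsOpen Ω)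
    (hφ : ContDiffOn ℝ ∞ φ Ω) (hx : ∀ p ∈ Ω, p.1.2.1 ≠ 0) (hX : ∀ p ∈ Ω, newX φ p ≠ 0)
    (hne : Ω.Nonempty) (hk : b 1 - b 0 = 1) :
    (∀ β, b β = β) ∧ ∀ p ∈ Ω, pd et (newT φ) p = 1 ∧ pd ey (newT φ) p = 0 ∧
      pd et (newY φ) p = 0 ∧ pd ey (newY φ) p ^ 2 = 1 ∧ newX φ p = p.1.2.1 * pd ey (newY φ) p := by
  have h1 : ∀ p ∈ Ω, |p.1.2.1| = |newX φ p| ∧ pd ey (newT φ) p = 0 ∧ pd et (newY φ) p = 0 ∧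
      newX φ p = p.1.2.1 * pd ex (newX φ) p := by
    intro p hp
    obtain ⟨h1, h2 | h2⟩ := H.exponent hΩ hφ hx hX hp
    · rw [hk, Real.rpow_one] at h1
      exact ⟨h1, h2.2⟩
    · linarith [h2.1]
  have hr : ∀ β, ∀ p ∈ Ω, pd et (newT φ) p = |p.1.2.1| ^ (β - b β) := by
    intro β p hp
    obtain ⟨e1, e2, e3, e4⟩ := h1 p hp
    have h2 := H.coeff p hp β
    have hxp := abs_pos.2 (hx p hp)
    have hsq : pd ex (newX φ) p ^ 2 = 1 := by
      have h3 := sq_eq_sq_iff_abs_eq_abs _ _ |>.2 e1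
      rw [e4] at h3
      have h4 := pow_ne_zero 2 (hx p hp)
      apply mul_left_cancel₀ h4
      linarith
    rw [hsq, e2, ← e1] at h2
    rw [Real.rpow_sub hxp, eq_div_iff (Real.rpow_pos_of_pos hxp _).ne']
    linarith
  obtain ⟨sT, sX, sY, sU⟩ := contDiffOn_comps hφ
  have key := fun β p (hp : p ∈ Ω) => eq_one_of_eq_rpow hΩ (contDiffOn_pd hΩ sT et) hx
    (fun q hq => by rw [pd_comm hΩ sT hq, pd_eq_zero hΩ H.T_x hq]) (hr β) hp
  obtain ⟨p₀, hp₀⟩ := hne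
  refine ⟨fun β => by linarith [(key β p₀ hp₀).1], fun p hp => ?_⟩
  obtain ⟨e1, e2, e3, e4⟩ := h1 p hp
  have e5 := (key 0 p hp).2
  have e6 := H.moebius p hp
  rw [e2, e3, e5] at e6
  have e7 : newX φ p = p.1.2.1 * pd ey (newY φ) p := by linarith
  refine ⟨e5, e2, e3, ?_, e7⟩
  have h3 := sq_eq_sq_iff_abs_eq_abs _ _ |>.2 e1
  rw [e7] at h3
  apply mul_left_cancel₀ (pow_ne_zero 2 (hx p hp))
  linarith

/-- The case `|x̃| = 1 / |x|`: the equation for the coefficients says that `t̃_y²` is a power of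
`|x|`. -/
lemma DeterminingEquations.second_case (H : DeterminingEquations Ω φ b) (hΩ : IsOpen Ω)
    (hφ : ContDiffOn ℝ ∞ φ Ω) (hx : ∀ p ∈ Ω, p.1.2.1 ≠ 0) (hX : ∀ p ∈ Ω, newX φ p ≠ 0)
    (hne : Ω.Nonempty) (hk : b 1 - b 0 = -1) :
    (∀ β, b β = 5 - β) ∧ ∀ p ∈ Ω, pd et (newT φ) p = 0 ∧ p.1.2.1 * pd ey (newT φ) p = |p.1.2.1| ∧
      pd et (newY φ) p ^ 2 = 1 ∧ pd ey (newY φ) p = 0 ∧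
      newX φ p * (p.1.2.1 * pd ey (newT φ) p) = pd et (newY φ) p := by
  have h1 : ∀ p ∈ Ω, |p.1.2.1| * |newX φ p| = 1 ∧ pd et (newT φ) p = 0 ∧ pd ey (newY φ) p = 0 ∧
      newX φ p = -(p.1.2.1 * pd ex (newX φ) p) := by
    intro p hp
    obtain ⟨h1, h2 | h2⟩ := H.exponent hΩ hφ hx hX hp
    · linarith [h2.1]
    · rw [hk, Real.rpow_neg_one] at h1
      refine ⟨?_, h2.2⟩
      rw [h1]
      exact inv_mul_cancel₀ (abs_pos.2 (hX p hp)).ne'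
  have hXx2 : ∀ p ∈ Ω, newX φ p ^ 2 * p.1.2.1 ^ 2 = 1 := by
    intro p hp
    have := (h1 p hp).1
    rw [← sq_abs, ← sq_abs p.1.2.1, ← mul_pow, mul_comm, this, one_pow]
  have hr : ∀ β, ∀ p ∈ Ω, pd ey (newT φ) p ^ 2 = |p.1.2.1| ^ (2 * (β + b β - 5)) := by
    intro β p hp
    obtain ⟨e1, e2, e3, e4⟩ := h1 p hp
    have h2 := H.coeff p hp β
    have hx0 := hx p hp
    have hxp := abs_pos.2 hx0
    have hsq : pd ex (newX φ) p ^ 2 * p.1.2.1 ^ 4 = 1 := by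
      have h3 := hXx2 p hp
      rw [e4] at h3
      linarith
    have hXa : |newX φ p| = |p.1.2.1|⁻¹ := (eq_inv_of_mul_eq_one_right e1)
    rw [e2, hXa, Real.inv_rpow hxp.le, zero_add] at h2
    have hp1 := Real.rpow_pos_of_pos hxp β
    have hp2 := Real.rpow_pos_of_pos hxp (b β)
    have h3 : p.1.2.1 ^ 5 * pd ey (newT φ) p = |p.1.2.1| ^ β * |p.1.2.1| ^ b β := by
      field_simp at h2
      linear_combination (-p.1.2.1 ^ 4) * h2 + |p.1.2.1| ^ β * |p.1.2.1| ^ b β * hsq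
    have h4 : |p.1.2.1| ^ (β + b β - 5) = |p.1.2.1| ^ β * |p.1.2.1| ^ b β / |p.1.2.1| ^ 5 := by
      rw [Real.rpow_sub hxp, Real.rpow_add hxp]
      norm_cast
    rw [mul_comm (2 : ℝ), Real.rpow_mul hxp.le, h4, ← h3]
    have h5 : |p.1.2.1| ^ 5 ≠ 0 := pow_ne_zero _ hxp.ne'
    rw [Real.rpow_two, div_pow, eq_div_iff (pow_ne_zero _ h5), ← abs_pow, sq_abs]
    ring
  obtain ⟨sT, sX, sY, sU⟩ := contDiffOn_comps hφ
  have sTy := contDiffOn_pd hΩ sT ey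
  have key := fun β p (hp : p ∈ Ω) => eq_one_of_eq_rpow (F := fun q => pd ey (newT φ) q ^ 2) hΩ
    (sTy.pow 2) hx
    (fun q hq => by
      rw [pd_sq (diffAt hΩ sTy hq), pd_comm hΩ sT hq, pd_eq_zero hΩ H.T_x hq, mul_zero]) (hr β) hp
  have hb : ∀ β, b β = 5 - β := by
    obtain ⟨p₀, hp₀⟩ := hne
    exact fun β => by linarith [(key β p₀ hp₀).1]
  refine ⟨hb, fun p hp => ?_⟩
  obtain ⟨e1, e2, e3, e4⟩ := h1 p hp
  have e5 := (key 0 p hp).2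
  have e6 := H.moebius p hp
  rw [e2, e3] at e6
  have e7 : newX φ p * (p.1.2.1 * pd ey (newT φ) p) = pd et (newY φ) p := by linarith
  -- The sign is fixed by the positivity of the denominator of the fractional linear function.
  have hpos : 0 < p.1.2.1 * pd ey (newT φ) p := by
    have h2 := H.coeff p hp 0
    rw [e2, zero_add, Real.rpow_zero, one_mul] at h2
    have h3 : 0 < pd ex (newX φ) p ^ 2 := by
      have := H.X_x p hp
      positivity
    rw [h2] at h3
    exact pos_of_mul_pos_right h3 (Real.rpow_nonneg (abs_nonneg _) _)
  refine ⟨e2, ?_, ?_, e3, e7⟩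
  · rw [← abs_of_pos hpos, abs_mul, ← Real.sqrt_sq_eq_abs (pd ey (newT φ) p), e5, Real.sqrt_one,
      mul_one]
  · rw [← e7, mul_pow, mul_pow, e5, mul_one, hXx2 p hp]

end Solve

/-! ### Classification on a connected domain -/

section Global

variable {Ω : Set Vars} {φ : Vars → Vars} {b : ℝ → ℝ}

lemma subset_closure_x_ne (hΩ : IsOpen Ω) (c : ℝ) : Ω ⊆ closure {p ∈ Ω | p.1.2.1 ≠ c} := by
  intro p hp
  have h1 : ContinuousAt (fun s : ℝ => p + s • ex) 0 := by fun_prop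
  have h2 : Tendsto (fun s : ℝ => p + s • ex) (𝓝[≠] 0) (𝓝 p) := by
    have := h1.tendsto.mono_left (nhdsWithin_le_nhds (s := {0}ᶜ))
    simpa using this
  refine mem_closure_of_tendsto h2 ?_
  have h3 : ∀ᶠ s : ℝ in 𝓝[≠] 0, p.1.2.1 + s ≠ c := by
    by_cases hc : p.1.2.1 = c
    · filter_upwards [self_mem_nhdsWithin] with s hs h
      exact hs (by simpa [hc] using h)
    · have h4 : ContinuousAt (fun s : ℝ => p.1.2.1 + s) 0 := by fun_prop
      exact (h4.eventually_ne (by simpa using hc)).filter_mono nhdsWithin_le_nhds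
  filter_upwards [(eventually_line hΩ hp ex).filter_mono nhdsWithin_le_nhds, h3] with s h4 h5
  exact ⟨h4, by simpa using h5⟩

lemma isOpen_x_ne (hΩ : IsOpen Ω) (c : ℝ) : IsOpen {p ∈ Ω | p.1.2.1 ≠ c} :=
  hΩ.inter (isOpen_ne.preimage (by fun_prop : Continuous fun p : Vars => p.1.2.1))

/-- The points of `Ω` where `x ≠ 0`, `|x| ≠ 1` and `x̃ ≠ 0`. -/
def regularPart (Ω : Set Vars) (φ : Vars → Vars) : Set Vars :=
  {p ∈ {p ∈ {p ∈ {p ∈ Ω | newX φ p ≠ 0} | p.1.2.1 ≠ 0} | p.1.2.1 ≠ 1} | p.1.2.1 ≠ -1}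

lemma isOpen_newX_ne (hΩ : IsOpen Ω) (hφ : ContDiffOn ℝ ∞ φ Ω) :
    IsOpen {p ∈ Ω | newX φ p ≠ 0} :=
  (contDiffOn_comps hφ).2.1.continuousOn.isOpen_inter_preimage hΩ isOpen_ne

lemma isOpen_regularPart (hΩ : IsOpen Ω) (hφ : ContDiffOn ℝ ∞ φ Ω) :
    IsOpen (regularPart Ω φ) :=
  isOpen_x_ne (isOpen_x_ne (isOpen_x_ne (isOpen_newX_ne hΩ hφ) 0) 1) (-1)

/-- Since `x̃` is a submersion, it does not vanish on an open set. -/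
lemma subset_closure_regularPart (hΩ : IsOpen Ω) (hφ : ContDiffOn ℝ ∞ φ Ω)
    (hinj : ∀ p ∈ Ω, ∀ v, fderiv ℝ φ p v = 0 → v = 0) : Ω ⊆ closure (regularPart Ω φ) := by
  have h0 := isOpen_newX_ne hΩ hφ
  have h1 : Ω ⊆ closure {p ∈ Ω | newX φ p ≠ 0} := by
    intro p hp
    rw [mem_closure_iff]
    intro V hV hpV
    by_contra hemp
    have h2 : ∀ q ∈ V ∩ Ω, newX φ q = 0 := by
      intro q hq
      by_contra h3
      exact hemp ⟨q, hq.1, hq.2, h3⟩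
    obtain ⟨v, hv⟩ := surj_of_inj (hinj p hp) ((0, 1, 0), 0)
    have h3 := pd_eq_zero (hV.inter hΩ) h2 ⟨hpV, hp⟩ v
    rw [fderiv_eq_comps ((hφ.contDiffAt (hΩ.mem_nhds hp)).differentiableAt (by simp)), h3] at hv
    simpa using congrArg (fun q : Vars => q.1.2.1) hv
  have step : ∀ {A B : Set Vars}, A ⊆ closure B → closure A ⊆ closure B := fun h =>
    closure_minimal h isClosed_closure
  exact h1.trans (step ((subset_closure_x_ne h0 0).trans (step
    ((subset_closure_x_ne (isOpen_x_ne h0 0) 1).trans (step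
      (subset_closure_x_ne (isOpen_x_ne (isOpen_x_ne h0 0) 1) (-1)))))))

lemma regularPart_subset : regularPart Ω φ ⊆ Ω := fun _ hp => hp.1.1.1.1

/-- On a connected set where `x` does not vanish the sign of `x` is constant. -/
lemma exists_sign (hc : IsConnected Ω) (hx : ∀ p ∈ Ω, p.1.2.1 ≠ 0) :
    ∃ s : ℝ, (s = 1 ∨ s = -1) ∧ ∀ p ∈ Ω, Real.sign p.1.2.1 = s := by
  have hcont : ContinuousOn (fun p : Vars => p.1.2.1) Ω := by fun_prop
  obtain ⟨p₀, hp₀⟩ := hc.nonempty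
  have key : ∀ p ∈ Ω, ∀ q ∈ Ω, p.1.2.1 < 0 → 0 < q.1.2.1 → False := by
    intro p hp q hq h1 h2
    obtain ⟨r, hr, hr0⟩ := hc.isPreconnected.intermediate_value hp hq hcont ⟨h1.le, h2.le⟩
    exact hx r hr hr0
  rcases lt_or_gt_of_ne (hx p₀ hp₀) with h | h
  · refine ⟨-1, Or.inr rfl, fun p hp => ?_⟩
    rcases lt_or_gt_of_ne (hx p hp) with h' | h'
    · exact Real.sign_of_neg h'
    · exact (key p₀ hp₀ p hp h h').elim
  · refine ⟨1, Or.inl rfl, fun p hp => ?_⟩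
    rcases lt_or_gt_of_ne (hx p hp) with h' | h'
    · exact (key p hp p₀ hp₀ h' h).elim
    · exact Real.sign_of_pos h'

lemma exists_sign_of_sq (hc : IsConnected Ω) {F : Vars → ℝ} (hF : ContinuousOn F Ω)
    (h : ∀ p ∈ Ω, F p ^ 2 = 1) : ∃ ε : ℝ, (ε = 1 ∨ ε = -1) ∧ ∀ p ∈ Ω, F p = ε := by
  rcases hc.isPreconnected.eq_or_eq_neg_of_sq_eq (g := fun _ => (1 : ℝ)) hF continuousOn_const
    (fun p hp => by simpa using h p hp) (fun _ => one_ne_zero) with h1 | h1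
  · exact ⟨1, Or.inl rfl, fun p hp => h1 hp⟩
  · exact ⟨-1, Or.inr rfl, fun p hp => h1 hp⟩

/-- Since the equation for `ũ` holds for all `β`, it splits with respect to the powers of `|x|`. -/
lemma split_powers {x a d₀ d₁ d₂ : ℝ} (hx1 : x ≠ 1) (hx2 : x ≠ -1)
    (h : ∀ β r : ℝ, a = |x| ^ β * (d₀ + 2 * r * d₁ + r ^ 2 * d₂)) :
    a = 0 ∧ d₀ = 0 ∧ d₁ = 0 ∧ d₂ = 0 := by
  have h1 : |x| ≠ 1 := by
    intro h
    rcases eq_or_eq_neg_of_abs_eq h with h | h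
    · exact hx1 h
    · exact hx2 h
  have hq : ∀ r : ℝ, d₀ + 2 * r * d₁ + r ^ 2 * d₂ = 0 := by
    intro r
    have e0 := h 0 r
    have e1 := h 1 r
    rw [Real.rpow_zero] at e0
    rw [Real.rpow_one] at e1
    have e2 : (|x| - 1) * (d₀ + 2 * r * d₁ + r ^ 2 * d₂) = 0 := by linarith
    exact (mul_eq_zero.1 e2).resolve_left (sub_ne_zero.2 h1)
  have q0 := hq 0
  have q1 := hq 1
  have q2 := hq (-1)
  refine ⟨by rw [h 0 0, hq 0, mul_zero], by linarith, by linarith, by linarith⟩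

/-- Extension of an identity from the regular part by continuity. -/
lemma extend (hΩ : IsOpen Ω) (hφ : ContDiffOn ℝ ∞ φ Ω)
    (hinj : ∀ p ∈ Ω, ∀ v, fderiv ℝ φ p v = 0 → v = 0) {F G : Vars → ℝ} (hF : ContinuousOn F Ω)
    (hG : ContinuousOn G Ω) (h : ∀ p ∈ regularPart Ω φ, F p = G p) : ∀ p ∈ Ω, F p = G p :=
  EqOn.of_subset_closure (s := regularPart Ω φ) h hF hG regularPart_subset
    (subset_closure_regularPart hΩ hφ hinj)

/-- A transformation that maps every equation of the class to an equation of the class is of one of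
the two forms. -/
lemma classify (hΩ : IsOpen Ω) (hc : IsConnected Ω) (hφ : ContDiffOn ℝ ∞ φ Ω)
    (hinj : ∀ p ∈ Ω, ∀ v, fderiv ℝ φ p v = 0 → v = 0) (h : ∀ β, MapsEquation Ω φ β (b β)) :
    ((∀ β, b β = β) ∧ ∃ ε c₀ c₁ c₂ c₃ c₄ c₅ : ℝ, (ε = 1 ∨ ε = -1) ∧ ∀ p ∈ Ω,
      φ p = ((p.1.1 + c₀, ε * p.1.2.1, ε * p.1.2.2 + c₁),
        c₂ * p.2 + c₃ * (p.1.1 * p.1.2.1 - p.1.2.2) + c₄ * p.1.2.1 + c₅)) ∨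
    ((∀ β, b β = 5 - β) ∧ (∀ p ∈ Ω, p.1.2.1 ≠ 0) ∧
      ∃ ε c₀ c₁ c₂ c₃ c₄ c₅ : ℝ, (ε = 1 ∨ ε = -1) ∧ ∀ p ∈ Ω,
      φ p = ((Real.sign p.1.2.1 * p.1.2.2 + c₀, ε / p.1.2.1, ε * Real.sign p.1.2.1 * p.1.1 + c₁),
        c₂ / p.1.2.1 * p.2 + c₃ * (p.1.1 - p.1.2.2 / p.1.2.1) + c₄ / p.1.2.1 + c₅)) := by
  obtain ⟨sT, sX, sY, sU⟩ := contDiffOn_comps hφ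
  have ext := fun F G hF hG => extend (F := F) (G := G) hΩ hφ hinj hF hG
  have hcx : ContinuousOn (fun p : Vars => p.1.2.1) Ω := by fun_prop
  have hO := isOpen_regularPart hΩ hφ
  have hφ' := hφ.mono (regularPart_subset (Ω := Ω) (φ := φ))
  have hx : ∀ p ∈ regularPart Ω φ, p.1.2.1 ≠ 0 := fun p hp => hp.1.1.2
  have hx1 : ∀ p ∈ regularPart Ω φ, p.1.2.1 ≠ 1 := fun p hp => hp.1.2
  have hx2 : ∀ p ∈ regularPart Ω φ, p.1.2.1 ≠ -1 := fun p hp => hp.2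
  have hX : ∀ p ∈ regularPart Ω φ, newX φ p ≠ 0 := fun p hp => hp.1.1.1.2
  have hne : (regularPart Ω φ).Nonempty :=
    closure_nonempty_iff.1 (hc.nonempty.mono (subset_closure_regularPart hΩ hφ hinj))
  have H := determiningEquations hO regularPart_subset hφ'
    (fun p hp => hinj p (regularPart_subset hp)) hx hX h
  have cpd : ∀ {F : Vars → ℝ} (e : Vars), ContDiffOn ℝ ∞ F Ω → ContinuousOn (pd e F) Ω :=
    fun e hF => (contDiffOn_pd hΩ hF e).continuousOn
  have Tx := ext _ _ (cpd ex sT) continuousOn_const H.T_x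
  have Tu := ext _ _ (cpd eu sT) continuousOn_const H.T_u
  have Yx := ext _ _ (cpd ex sY) continuousOn_const H.Y_x
  have Yu := ext _ _ (cpd eu sY) continuousOn_const H.Y_u
  have hk : b 1 - b 0 = 1 ∨ b 1 - b 0 = -1 := by
    obtain ⟨p₀, hp₀⟩ := hne
    rcases (H.exponent hO hφ' hx hX hp₀).2 with h | h
    · exact Or.inl h.1
    · exact Or.inr h.1
  rcases hk with hk | hk
  · left
    obtain ⟨hb, h1⟩ := H.first_case hO hφ' hx hX hne hk
    have Tt := ext _ _ (cpd et sT) continuousOn_const fun p hp => (h1 p hp).1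
    have Ty := ext _ _ (cpd ey sT) continuousOn_const fun p hp => (h1 p hp).2.1
    have Yt := ext _ _ (cpd et sY) continuousOn_const fun p hp => (h1 p hp).2.2.1
    have Yy2 := ext _ _ ((cpd ey sY).pow 2) continuousOn_const fun p hp => (h1 p hp).2.2.2.1
    obtain ⟨ε, hε, Yy⟩ := exists_sign_of_sq hc (cpd ey sY) Yy2
    have hXε : ∀ p ∈ Ω, newX φ p = p.1.2.1 * ε := by
      refine ext _ (fun p => p.1.2.1 * ε) sX.continuousOn (by fun_prop) fun p hp => ?_
      rw [(h1 p hp).2.2.2.2, Yy p (regularPart_subset hp)]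
    have hε0 : ε ≠ 0 := by rcases hε with h | h <;> simp [h]
    obtain ⟨c₀, hT⟩ := exists_eq_add_const hΩ hc sT (contDiff_model 1 0 0 0 0).contDiffOn
      (fun p hp => by rw [pd_model, Tt p hp]; simp) (fun p hp => by rw [pd_model, Tx p hp]; simp)
      (fun p hp => by rw [pd_model, Ty p hp]; simp) (fun p hp => by rw [pd_model, Tu p hp]; simp)
    obtain ⟨c₁, hY⟩ := exists_eq_add_const hΩ hc sY (contDiff_model 0 0 0 0 ε).contDiffOn
      (fun p hp => by rw [pd_model, Yt p hp]; simp) (fun p hp => by rw [pd_model, Yx p hp]; simp)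
      (fun p hp => by rw [pd_model, Yy p hp]; simp) (fun p hp => by rw [pd_model, Yu p hp]; simp)
    have pdX : ∀ e, ∀ p ∈ Ω, pd e (newX φ) p = e.1.2.1 * ε := by
      intro e p hp
      have h2 := pd_x_mul (F := fun _ => ε) (p := p) (differentiableAt_const _) e
      rw [pd_congr hΩ (G := fun q : Vars => q.1.2.1 * ε) hXε hp, h2]
      simp [pd]
    have hpot : ∀ p ∈ regularPart Ω φ, pd et (newU φ) p + p.1.2.1 * pd ey (newU φ) p = 0 ∧
        pd ex (pd ex (newU φ)) p = 0 ∧ pd ex (pd eu (newU φ)) p = 0 ∧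
        pd eu (pd eu (newU φ)) p = 0 := by
      intro p hp
      have hp' := regularPart_subset hp
      refine split_powers (hx1 p hp) (hx2 p hp) fun β r => ?_
      have h2 := H.potential p hp β r
      rw [pd_eq_zero hΩ (pdX ex) hp', pd_eq_zero hΩ (pdX eu) hp', pd_eq_zero hΩ (pdX eu) hp',
        pdX ex p hp', pdX et p hp', pdX ey p hp'] at h2
      apply mul_left_cancel₀ hε0
      simp only at h2
      linear_combination h2
    obtain ⟨c₂, c₃, c₄, c₅, hU⟩ := solve_linear_system hΩ hc sU
      (ext _ _ (cpd ex (contDiffOn_pd hΩ sU ex)) continuousOn_const fun p hp => (hpot p hp).2.1)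
      (ext _ _ (cpd ex (contDiffOn_pd hΩ sU eu)) continuousOn_const fun p hp => (hpot p hp).2.2.1)
      (ext _ _ (cpd eu (contDiffOn_pd hΩ sU eu)) continuousOn_const fun p hp => (hpot p hp).2.2.2)
      (ext _ (fun _ => 0) ((cpd et sU).add (hcx.mul (cpd ey sU))) continuousOn_const
        fun p hp => (hpot p hp).1)
    refine ⟨hb, ε, c₀, c₁, c₂, c₃, c₄, c₅, hε, fun p hp => ?_⟩
    refine Prod.ext (Prod.ext ?_ (Prod.ext ?_ ?_)) ?_
    · simpa [newT] using hT p hp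
    · simpa [newX, mul_comm] using hXε p hp
    · simpa [newY] using hY p hp
    · exact hU p hp
  · right
    obtain ⟨hb, h1⟩ := H.second_case hO hφ' hx hX hne hk
    have Tt := ext _ _ (cpd et sT) continuousOn_const fun p hp => (h1 p hp).1
    have Ty := ext _ _ (hcx.mul (cpd ey sT)) hcx.abs fun p hp => (h1 p hp).2.1
    have Yt2 := ext _ _ ((cpd et sY).pow 2) continuousOn_const fun p hp => (h1 p hp).2.2.1
    have Yy := ext _ _ (cpd ey sY) continuousOn_const fun p hp => (h1 p hp).2.2.2.1
    have XY := ext _ _ (sX.continuousOn.mul (hcx.mul (cpd ey sT))) (cpd et sY)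
      fun p hp => (h1 p hp).2.2.2.2
    obtain ⟨η, hη, Yt⟩ := exists_sign_of_sq hc (cpd et sY) Yt2
    have hη0 : η ≠ 0 := by rcases hη with h | h <;> simp [h]
    -- The equality `x x̃ t̃_y = ỹ_t = ±1` holds on all of `Ω`, so `x` vanishes nowhere on `Ω`.
    have hx0 : ∀ p ∈ Ω, p.1.2.1 ≠ 0 := by
      intro p hp h0
      have h2 := XY p hp
      simp only [Pi.mul_apply] at h2
      rw [h0, zero_mul, mul_zero, Yt p hp] at h2
      exact hη0 h2.symm
    obtain ⟨s, hs, hsign⟩ := exists_sign hc hx0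
    have hs2 : s * s = 1 := by rcases hs with h | h <;> simp [h]
    have habs : ∀ p ∈ Ω, |p.1.2.1| = p.1.2.1 * s := by
      intro p hp
      rw [← hsign p hp]
      rcases lt_or_gt_of_ne (hx0 p hp) with h | h
      · rw [abs_of_neg h, Real.sign_of_neg h]; ring
      · rw [abs_of_pos h, Real.sign_of_pos h]; ring
    have Tys : ∀ p ∈ Ω, pd ey (newT φ) p = s := by
      intro p hp
      have h2 := Ty p hp
      simp only [Pi.mul_apply, habs p hp] at h2
      exact mul_left_cancel₀ (hx0 p hp) h2
    have hXε : ∀ p ∈ Ω, p.1.2.1 * newX φ p = η * s := by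
      intro p hp
      have h2 := XY p hp
      simp only [Pi.mul_apply] at h2
      rw [Tys p hp, Yt p hp] at h2
      linear_combination s * h2 - p.1.2.1 * newX φ p * hs2
    obtain ⟨c₀, hT⟩ := exists_eq_add_const hΩ hc sT (contDiff_model 0 0 0 0 s).contDiffOn
      (fun p hp => by rw [pd_model, Tt p hp]; simp) (fun p hp => by rw [pd_model, Tx p hp]; simp)
      (fun p hp => by rw [pd_model, Tys p hp]; simp) (fun p hp => by rw [pd_model, Tu p hp]; simp)
    obtain ⟨c₁, hY⟩ := exists_eq_add_const hΩ hc sY (contDiff_model η 0 0 0 0).contDiffOn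
      (fun p hp => by rw [pd_model, Yt p hp]; simp) (fun p hp => by rw [pd_model, Yx p hp]; simp)
      (fun p hp => by rw [pd_model, Yy p hp]; simp) (fun p hp => by rw [pd_model, Yu p hp]; simp)
    have sPd := fun {F : Vars → ℝ} (hF : ContDiffOn ℝ ∞ F Ω) e => contDiffOn_pd hΩ hF e
    have dx : ∀ {F : Vars → ℝ} {p}, DifferentiableAt ℝ F p →
        DifferentiableAt ℝ (fun q : Vars => q.1.2.1 * F q) p := by
      intro F p hF
      exact xC.differentiableAt.mul hF
    have pdX : ∀ e, ∀ p ∈ Ω, e.1.2.1 * newX φ p + p.1.2.1 * pd e (newX φ) p = 0 := by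
      intro e p hp
      rw [← pd_x_mul (diffAt hΩ sX hp), pd_eq_zero hΩ hXε hp]
    have pdX0 : ∀ e : Vars, e.1.2.1 = 0 → ∀ p ∈ Ω, pd e (newX φ) p = 0 := by
      intro e he p hp
      have := pdX e p hp
      rw [he, zero_mul, zero_add] at this
      exact (mul_eq_zero.1 this).resolve_left (hx0 p hp)
    have pdXx : ∀ p ∈ Ω, newX φ p + p.1.2.1 * pd ex (newX φ) p = 0 := by
      intro p hp
      simpa using pdX ex p hp
    have pdXxx : ∀ p ∈ Ω, 2 * pd ex (newX φ) p + p.1.2.1 * pd ex (pd ex (newX φ)) p = 0 := by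
      intro p hp
      have h2 := pd_eq_zero hΩ pdXx hp ex
      rw [pd_add (diffAt hΩ sX hp) (dx (diffAt hΩ (sPd sX ex) hp)),
        pd_x_mul (diffAt hΩ (sPd sX ex) hp)] at h2
      linear_combination h2
    -- The function `x ũ` satisfies the same linear system as `ũ` does in the first case.
    set V : Vars → ℝ := fun q => q.1.2.1 * newU φ q with hV
    have sV : ContDiffOn ℝ ∞ V Ω := (xC.contDiff.contDiffOn).mul sU
    have V1 : ∀ e, ∀ p ∈ Ω, pd e V p = e.1.2.1 * newU φ p + p.1.2.1 * pd e (newU φ) p :=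
      fun e p hp => pd_x_mul (diffAt hΩ sU hp) e
    have V2 : ∀ e, ∀ p ∈ Ω, pd e (pd eu V) p = e.1.2.1 * pd eu (newU φ) p +
        p.1.2.1 * pd e (pd eu (newU φ)) p := by
      intro e p hp
      rw [pd_congr hΩ (G := fun q => q.1.2.1 * pd eu (newU φ) q)
        (fun q hq => by rw [V1 eu q hq]; simp) hp, pd_x_mul (diffAt hΩ (sPd sU eu) hp)]
    have V3 : ∀ p ∈ Ω, pd ex (pd ex V) p = 2 * pd ex (newU φ) p +
        p.1.2.1 * pd ex (pd ex (newU φ)) p := by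
      intro p hp
      rw [pd_congr hΩ (G := fun q => newU φ q + q.1.2.1 * pd ex (newU φ) q)
        (fun q hq => by rw [V1 ex q hq]; simp) hp, pd_add (diffAt hΩ sU hp)
        (dx (diffAt hΩ (sPd sU ex) hp)), pd_x_mul (diffAt hΩ (sPd sU ex) hp)]
      ring
    have hpot : ∀ p ∈ regularPart Ω φ, pd et V p + p.1.2.1 * pd ey V p = 0 ∧
        pd ex (pd ex V) p = 0 ∧ pd ex (pd eu V) p = 0 ∧ pd eu (pd eu V) p = 0 := by
      intro p hp
      have hp' := regularPart_subset hp
      refine split_powers (hx1 p hp) (hx2 p hp) fun β r => ?_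
      have h2 := H.potential p hp β r
      have e1 := pdXxx p hp'
      rw [pd_eq_zero hΩ (pdX0 eu rfl) hp', pd_eq_zero hΩ (pdX0 eu rfl) hp',
        pdX0 et rfl p hp', pdX0 ey rfl p hp'] at h2
      rw [V1 et p hp', V1 ey p hp', V2 ex p hp', V2 eu p hp', V3 p hp']
      apply mul_left_cancel₀ (H.X_x p hp)
      simp only at h2 ⊢
      linear_combination p.1.2.1 * h2 - |p.1.2.1| ^ β *
        (pd ex (newU φ) p + r * pd eu (newU φ) p) * e1
    obtain ⟨c₂, c₃, c₄, c₅, hU⟩ := solve_linear_system hΩ hc sV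
      (ext _ _ (cpd ex (contDiffOn_pd hΩ sV ex)) continuousOn_const fun p hp => (hpot p hp).2.1)
      (ext _ _ (cpd ex (contDiffOn_pd hΩ sV eu)) continuousOn_const fun p hp => (hpot p hp).2.2.1)
      (ext _ _ (cpd eu (contDiffOn_pd hΩ sV eu)) continuousOn_const fun p hp => (hpot p hp).2.2.2)
      (ext _ (fun _ => 0) ((cpd et sV).add (hcx.mul (cpd ey sV))) continuousOn_const
        fun p hp => (hpot p hp).1)
    refine ⟨hb, hx0, η * s, c₀, c₁, c₂, c₃, c₅, c₄, ?_, fun p hp => ?_⟩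
    · rcases hη with h | h <;> rcases hs with h' | h' <;> simp [h, h']
    have hxp := hx0 p hp
    rw [hsign p hp]
    refine Prod.ext (Prod.ext ?_ (Prod.ext ?_ ?_)) ?_
    · simpa [newT] using hT p hp
    · have := hXε p hp
      simp only
      rw [eq_div_iff hxp, ← this, mul_comm]
      rfl
    · have h3 : η * s * s = η := by rw [mul_assoc, hs2, mul_one]
      simp only [h3]
      simpa [newY] using hY p hp
    · have h3 := hU p hp
      simp only [hV] at h3
      have h4 : newU φ p = (φ p).2 := rfl
      rw [h4] at h3
      apply mul_left_cancel₀ hxp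
      rw [h3]
      field_simp
      ring

end Global

/-! ### The two families act on the class -/

section Verification

variable {f g : Base → ℝ} {z e : Base}

lemma differentiableAt_fderiv_apply (hf : ContDiffAt ℝ 2 f z) (e : Base) :
    DifferentiableAt ℝ (fun w => fderiv ℝ f w e) z := by
  have h1 : DifferentiableAt ℝ (fderiv ℝ f) z :=
    (hf.fderiv_right (m := 1) (by norm_num)).differentiableAt (by norm_num)
  exact h1.clm_apply (differentiableAt_const _)

lemma eventually_differentiableAt (hf : ContDiffAt ℝ 2 f z) :
    ∀ᶠ w in 𝓝 z, DifferentiableAt ℝ f w := by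
  filter_upwards [hf.eventually (by simp)] with w hw using hw.differentiableAt (by norm_num)

lemma hasDerivAt_base_line (z e : Base) : HasDerivAt (fun s : ℝ => z + s • e) e 0 := by
  simpa using ((hasDerivAt_id (0 : ℝ)).smul_const e).const_add z

lemma hasDerivAt_coords (z e : Base) : HasDerivAt (fun s : ℝ => (z + s • e).1) e.1 0 ∧
    HasDerivAt (fun s : ℝ => (z + s • e).2.1) e.2.1 0 ∧
    HasDerivAt (fun s : ℝ => (z + s • e).2.2) e.2.2 0 := by
  have h : ∀ a b : ℝ, HasDerivAt (fun s : ℝ => a + s * b) b 0 := fun a b => by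
    simpa using ((hasDerivAt_id (0 : ℝ)).mul_const b).const_add a
  exact ⟨h _ _, h _ _, h _ _⟩

lemma hasDerivAt_comp_line (hf : DifferentiableAt ℝ f z) (e : Base) :
    HasDerivAt (fun s : ℝ => f (z + s • e)) (fderiv ℝ f z e) 0 := by
  have h2 : HasFDerivAt f (fderiv ℝ f z) (z + (0 : ℝ) • e) := by simpa using hf.hasFDerivAt
  exact h2.comp_hasDerivAt 0 (hasDerivAt_base_line z e)

/-- Differentiation, in the direction `e`, of an identity between functions on the base. -/
lemma line_deriv_unique {Z : Base → Base} {F : Base → ℝ} {v : Base} {d : ℝ}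
    (hg : DifferentiableAt ℝ g (Z z)) (hZ : HasDerivAt (fun s : ℝ => Z (z + s • e)) v 0)
    (hF : HasDerivAt (fun s : ℝ => F (z + s • e)) d 0) (h : ∀ᶠ w in 𝓝 z, g (Z w) = F w) :
    fderiv ℝ g (Z z) v = d := by
  have h2 : HasFDerivAt g (fderiv ℝ g (Z z)) (Z (z + (0 : ℝ) • e)) := by
    simpa using hg.hasFDerivAt
  have h3 : HasDerivAt (fun s : ℝ => g (Z (z + s • e))) (fderiv ℝ g (Z z) v) 0 :=
    h2.comp_hasDerivAt 0 hZ
  have h4 : Tendsto (fun s : ℝ => z + s • e) (𝓝 0) (𝓝 z) := by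
    simpa using (hasDerivAt_base_line z e).continuousAt.tendsto
  exact h3.unique (hF.congr_of_eventuallyEq (h4.eventually h))

/-- Transformations of the first form preserve each equation of the class. -/
lemma mapsEquation_first {Ω : Set Vars} (hΩ : IsOpen Ω) {φ : Vars → Vars}
    {ε c₀ c₁ c₂ c₃ c₄ c₅ : ℝ} (hε : ε = 1 ∨ ε = -1) (hc : c₂ ≠ 0)
    (hφ : ∀ p ∈ Ω, φ p = ((p.1.1 + c₀, ε * p.1.2.1, ε * p.1.2.2 + c₁),
      c₂ * p.2 + c₃ * (p.1.1 * p.1.2.1 - p.1.2.2) + c₄ * p.1.2.1 + c₅)) (β : ℝ) :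
    MapsEquation Ω φ β β := by
  intro z f g hz hx hX hf hg hfg
  set Z : Base → Base := fun w => (w.1 + c₀, ε * w.2.1, ε * w.2.2 + c₁) with hZ
  have hΩz : ∀ᶠ w in 𝓝 z, (w, f w) ∈ Ω :=
    (continuousAt_id.prodMk hf.continuousAt).eventually_mem (hΩ.mem_nhds hz)
  have hφz : (φ (z, f z)).1 = Z z := by rw [hφ _ hz]
  rw [hφz] at hg hX ⊢
  have hε2 : ε * ε = 1 := by rcases hε with h | h <;> simp [h]
  have hgZ : ∀ᶠ w in 𝓝 z, g (Z w) =
      c₂ * f w + c₃ * (w.1 * w.2.1 - w.2.2) + c₄ * w.2.1 + c₅ := by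
    filter_upwards [hfg, hΩz] with w h1 h2
    rw [hφ _ h2] at h1
    exact h1
  have hZc : ContinuousAt Z z := by fun_prop
  have lZ : ∀ w e, HasDerivAt (fun s : ℝ => Z (w + s • e)) (e.1, ε * e.2.1, ε * e.2.2) 0 := by
    intro w e
    obtain ⟨ht, hx, hy⟩ := hasDerivAt_coords w e
    exact (ht.add_const c₀).prodMk ((hx.const_mul ε).prodMk
      ((hy.const_mul ε).add_const c₁))
  have first : ∀ᶠ w in 𝓝 z, ∀ e : Base, fderiv ℝ g (Z w) (e.1, ε * e.2.1, ε * e.2.2) =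
      c₂ * fderiv ℝ f w e + c₃ * (e.1 * w.2.1 + w.1 * e.2.1 - e.2.2) + c₄ * e.2.1 := by
    filter_upwards [hgZ.eventually_nhds, hZc.eventually (eventually_differentiableAt hg),
      eventually_differentiableAt hf] with w h1 h2 h3 e
    obtain ⟨ht, hx, hy⟩ := hasDerivAt_coords w e
    have hR := ((((hasDerivAt_comp_line h3 e).const_mul c₂).fun_add
      (((ht.fun_mul hx).fun_sub hy).const_mul c₃)).fun_add
      (hx.const_mul c₄)).add_const c₅
    rw [line_deriv_unique h2 (lZ w e) hR h1]
    simp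
  have hgx : ∀ᶠ w in 𝓝 z, fderiv ℝ g (Z w) (0, 1, 0) =
      ε * (c₂ * fderiv ℝ f w (0, 1, 0) + c₃ * w.1 + c₄) := by
    filter_upwards [first] with w hw
    have h1 := hw (0, 1, 0)
    rw [map_base] at h1
    simp only [smul_eq_mul, mul_zero, mul_one, zero_mul, zero_add, add_zero, sub_zero] at h1
    linear_combination ε * h1 - fderiv ℝ g (Z w) (0, 1, 0) * hε2
  have hgxx := by
    obtain ⟨ht, -, -⟩ := hasDerivAt_coords z (0, 1, 0)
    exact line_deriv_unique (g := fun w => fderiv ℝ g w (0, 1, 0))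
      (differentiableAt_fderiv_apply hg (0, 1, 0)) (lZ z (0, 1, 0))
      (((((hasDerivAt_comp_line (differentiableAt_fderiv_apply hf (0, 1, 0)) (0, 1, 0)).const_mul
        c₂).fun_add (ht.const_mul c₃)).add_const c₄).const_mul ε) hgx
  rw [map_base] at hgxx
  have ht := first.self_of_nhds (1, 0, 0)
  have hy := first.self_of_nhds (0, 0, 1)
  rw [map_base] at ht hy
  simp only [smul_eq_mul, mul_zero, mul_one, zero_mul, zero_add, add_zero, sub_zero, one_mul,
    zero_sub] at hgxx ht hy
  unfold SatisfiesAt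
  have hZx : (Z z).2.1 = ε * z.2.1 := rfl
  have habs : |ε * z.2.1| = |z.2.1| := by
    rcases hε with h | h <;> simp [h]
  rw [hZx, habs]
  have hε0 : ε ≠ 0 := by rcases hε with h | h <;> simp [h]
  have hxx := mul_left_cancel₀ hε0 hgxx
  rw [hxx, ht, mul_right_comm, hy, ← mul_right_inj' hc]
  constructor <;> intro h <;> linear_combination h

/-- Transformations of the second form map the equation with parameter `β` to the one with
parameter `5 - β`. -/
lemma mapsEquation_second {Ω : Set Vars} (hΩ : IsOpen Ω) {φ : Vars → Vars}
    {ε c₀ c₁ c₂ c₃ c₄ c₅ : ℝ} (hε : ε = 1 ∨ ε = -1) (hc : c₂ ≠ 0)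
    (hφ : ∀ p ∈ Ω, φ p = ((Real.sign p.1.2.1 * p.1.2.2 + c₀, ε / p.1.2.1,
      ε * Real.sign p.1.2.1 * p.1.1 + c₁),
      c₂ / p.1.2.1 * p.2 + c₃ * (p.1.1 - p.1.2.2 / p.1.2.1) + c₄ / p.1.2.1 + c₅)) (β : ℝ) :
    MapsEquation Ω φ β (5 - β) := by
  intro z f g hz hx hX hf hg hfg
  -- Near the point `z` the sign of `x` is a constant `σ`.
  obtain ⟨σ, hσ, hσz, hσn⟩ : ∃ σ : ℝ, (σ = 1 ∨ σ = -1) ∧ z.2.1 = σ * |z.2.1| ∧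
      ∀ᶠ w in 𝓝 z, Real.sign w.2.1 = σ := by
    have hcx : ContinuousAt (fun w : Base => w.2.1) z := by fun_prop
    rcases lt_or_gt_of_ne hx with h | h
    · exact ⟨-1, Or.inr rfl, by rw [abs_of_neg h]; ring,
        (hcx.eventually_lt_const h).mono fun w hw => Real.sign_of_neg hw⟩
    · exact ⟨1, Or.inl rfl, by rw [abs_of_pos h]; ring,
        (hcx.eventually_const_lt h).mono fun w hw => Real.sign_of_pos hw⟩
  set Z : Base → Base := fun w => (σ * w.2.2 + c₀, ε * w.2.1⁻¹, ε * σ * w.1 + c₁) with hZ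
  have hΩz : ∀ᶠ w in 𝓝 z, (w, f w) ∈ Ω :=
    (continuousAt_id.prodMk hf.continuousAt).eventually_mem (hΩ.mem_nhds hz)
  have hxn : ∀ᶠ w in 𝓝 z, w.2.1 ≠ 0 := by
    have hcx : ContinuousAt (fun w : Base => w.2.1) z := by fun_prop
    exact hcx.eventually_ne hx
  have hφz : (φ (z, f z)).1 = Z z := by
    rw [hφ _ hz]
    simp only [hσn.self_of_nhds, hZ, div_eq_mul_inv]
  rw [hφz] at hg hX ⊢
  have hε2 : ε * ε = 1 := by rcases hε with h | h <;> simp [h]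
  have hσ2 : σ * σ = 1 := by rcases hσ with h | h <;> simp [h]
  have hgZ : ∀ᶠ w in 𝓝 z, g (Z w) =
      c₂ * (w.2.1⁻¹ * f w) + c₃ * (w.1 - w.2.2 * w.2.1⁻¹) + c₄ * w.2.1⁻¹ + c₅ := by
    filter_upwards [hfg, hΩz, hσn] with w h1 h2 h3
    rw [hφ _ h2] at h1
    simp only [h3, div_eq_mul_inv] at h1
    rw [hZ]
    simp only
    rw [h1]
    ring
  have hZc : ContinuousAt Z z := by
    have : ContinuousAt (fun w : Base => w.2.1⁻¹) z :=
      (by fun_prop : ContinuousAt (fun w : Base => w.2.1) z).inv₀ hx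
    fun_prop
  have linv : ∀ w : Base, w.2.1 ≠ 0 → ∀ e : Base,
      HasDerivAt (fun s : ℝ => (w + s • e).2.1⁻¹) (-e.2.1 / w.2.1 ^ 2) 0 := by
    intro w hw e
    have h := (hasDerivAt_coords w e).2.1.fun_inv (by simpa using hw)
    simpa using h
  have lZ : ∀ w : Base, w.2.1 ≠ 0 → ∀ e, HasDerivAt (fun s : ℝ => Z (w + s • e))
      (σ * e.2.2, ε * (-e.2.1 / w.2.1 ^ 2), ε * σ * e.1) 0 := by
    intro w hw e
    obtain ⟨ht, hx, hy⟩ := hasDerivAt_coords w e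
    exact ((hy.const_mul σ).add_const c₀).prodMk (((linv w hw e).const_mul ε).prodMk
      ((ht.const_mul (ε * σ)).add_const c₁))
  have first : ∀ᶠ w in 𝓝 z, ∀ e : Base,
      fderiv ℝ g (Z w) (σ * e.2.2, ε * (-e.2.1 / w.2.1 ^ 2), ε * σ * e.1) =
      c₂ * (-e.2.1 / w.2.1 ^ 2 * f w + w.2.1⁻¹ * fderiv ℝ f w e) +
        c₃ * (e.1 - (e.2.2 * w.2.1⁻¹ + w.2.2 * (-e.2.1 / w.2.1 ^ 2))) +
        c₄ * (-e.2.1 / w.2.1 ^ 2) := by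
    filter_upwards [hgZ.eventually_nhds, hZc.eventually (eventually_differentiableAt hg),
      eventually_differentiableAt hf, hxn] with w h1 h2 h3 h4 e
    obtain ⟨ht, hx, hy⟩ := hasDerivAt_coords w e
    have hi := linv w h4 e
    have hR := ((((hi.fun_mul (hasDerivAt_comp_line h3 e)).const_mul c₂).fun_add
      ((ht.fun_sub (hy.fun_mul hi)).const_mul c₃)).fun_add
      (hi.const_mul c₄)).add_const c₅
    rw [line_deriv_unique h2 (lZ w h4 e) hR h1]
    simp
  have hgx : ∀ᶠ w in 𝓝 z, fderiv ℝ g (Z w) (0, 1, 0) =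
      ε * (c₂ * (f w - w.2.1 * fderiv ℝ f w (0, 1, 0)) - c₃ * w.2.2 + c₄) := by
    filter_upwards [first, hxn] with w hw h0
    have h1 := hw (0, 1, 0)
    rw [map_base] at h1
    simp only [smul_eq_mul, mul_zero, zero_mul, zero_add, add_zero] at h1
    field_simp at h1
    linear_combination (-ε) * h1 - fderiv ℝ g (Z w) (0, 1, 0) * hε2
  have hx0 := hx
  have hgxx := by
    obtain ⟨ht, hx, hy⟩ := hasDerivAt_coords z (0, 1, 0)
    exact line_deriv_unique (g := fun w => fderiv ℝ g w (0, 1, 0))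
      (differentiableAt_fderiv_apply hg (0, 1, 0)) (lZ z hx0 (0, 1, 0))
      ((((((hasDerivAt_comp_line (hf.differentiableAt (by norm_num)) (0, 1, 0)).fun_sub
        (hx.fun_mul (hasDerivAt_comp_line (differentiableAt_fderiv_apply hf (0, 1, 0))
          (0, 1, 0)))).const_mul c₂).fun_sub (hy.const_mul c₃)).add_const c₄).const_mul ε)
      hgx
  rw [map_base] at hgxx
  have ht := first.self_of_nhds (1, 0, 0)
  have hy := first.self_of_nhds (0, 0, 1)
  rw [map_base] at ht hy
  simp only [smul_eq_mul, mul_zero, mul_one, zero_mul, zero_add, add_zero, sub_zero, one_mul,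
    zero_sub, zero_smul, neg_zero, zero_div] at hgxx ht hy
  unfold SatisfiesAt
  have hZx : (Z z).2.1 = ε * z.2.1⁻¹ := rfl
  have hε0 : ε ≠ 0 := by rcases hε with h | h <;> simp [h]
  have hσ0 : σ ≠ 0 := by rcases hσ with h | h <;> simp [h]
  have hxp := abs_pos.2 hx
  have habs : |ε * z.2.1⁻¹| = |z.2.1|⁻¹ := by
    rw [abs_mul, abs_inv]
    rcases hε with h | h <;> simp [h]
  rw [hZx, habs, Real.inv_rpow hxp.le, Real.rpow_sub hxp]
  norm_cast
  set F := fderiv ℝ (fun w => fderiv ℝ f w (0, 1, 0)) z (0, 1, 0) with hF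
  set G := fderiv ℝ (fun w => fderiv ℝ g w (0, 1, 0)) (Z z) (0, 1, 0) with hG
  have hGF : G = c₂ * z.2.1 ^ 3 * F := by
    apply mul_left_cancel₀ hε0
    field_simp at hgxx
    linear_combination -ε * hgxx
  have hLHS : fderiv ℝ g (Z z) (1, 0, 0) + ε * z.2.1⁻¹ * fderiv ℝ g (Z z) (0, 0, 1) =
      c₂ * σ * (z.2.1 ^ 2)⁻¹ *
        (fderiv ℝ f z (1, 0, 0) + z.2.1 * fderiv ℝ f z (0, 0, 1)) := by
    field_simp at ht hy ⊢
    linear_combination σ * z.2.1 * hy + σ * ht - (z.2.1 ^ 2 * fderiv ℝ g (Z z) (1, 0, 0) +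
      z.2.1 * ε * fderiv ℝ g (Z z) (0, 0, 1)) * hσ2
  have hRHS : (|z.2.1| ^ 5 / |z.2.1| ^ β)⁻¹ * G =
      c₂ * σ * (z.2.1 ^ 2)⁻¹ * (|z.2.1| ^ β * F) := by
    have hβ := Real.rpow_pos_of_pos hxp β
    have h5 : z.2.1 ^ 5 = σ * |z.2.1| ^ 5 := by
      conv_lhs => rw [hσz]
      rw [mul_pow]
      rcases hσ with h | h <;> rw [h] <;> norm_num
    rw [hGF]
    field_simp
    linear_combination F * h5
  rw [hLHS, hRHS]
  have h0 : c₂ * σ * (z.2.1 ^ 2)⁻¹ ≠ 0 :=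
    mul_ne_zero (mul_ne_zero hc hσ0) (inv_ne_zero (pow_ne_zero _ hx))
  exact (mul_right_inj' h0).symm

end Verification

/-! ### Equivalence transformations and the discrete transformation -/

section Assembly

variable {Ω : Set Vars} {Ψ : Total → Total}

lemma det_ne_zero_of_leftInverse {Ψ₀ Φ : Total → Total} {q : Total} (h : Ψ =ᶠ[𝓝 q] Ψ₀)
    (hΨ : DifferentiableAt ℝ Ψ₀ q) (hΦ : DifferentiableAt ℝ Φ (Ψ₀ q))
    (hinv : ∀ᶠ r in 𝓝 q, Φ (Ψ₀ r) = r) : (fderiv ℝ Ψ q).det ≠ 0 := by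
  rw [h.fderiv_eq]
  have h1 : (fderiv ℝ Φ (Ψ₀ q)).comp (fderiv ℝ Ψ₀ q) = ContinuousLinearMap.id ℝ Total := by
    have h2 := hΦ.hasFDerivAt.comp q hΨ.hasFDerivAt
    exact h2.unique ((hasFDerivAt_id q).congr_of_eventuallyEq hinv)
  intro h0
  have h2 : (fderiv ℝ Φ (Ψ₀ q) : Total →ₗ[ℝ] Total) ∘ₗ
      (fderiv ℝ Ψ₀ q : Total →ₗ[ℝ] Total) = LinearMap.id :=
    congrArg (fun A : Total →L[ℝ] Total => (A : Total →ₗ[ℝ] Total)) h1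
  have h2 := congrArg LinearMap.det h2
  rw [LinearMap.det_comp, LinearMap.det_id] at h2
  have h3 : LinearMap.det (fderiv ℝ Ψ₀ q : Total →ₗ[ℝ] Total) = 0 := h0
  rw [h3, mul_zero] at h2
  exact zero_ne_one h2

lemma IsFirstForm.isEquivalenceTransformation (hΩ : IsOpen Ω) (h : IsFirstForm Ω Ψ) :
    IsEquivalenceTransformation Ω Ψ := by
  obtain ⟨ε, c₀, c₁, c₂, c₃, c₄, c₅, hε, hc, hΨ⟩ := h
  have hε2 : ε * ε = 1 := by rcases hε with h | h <;> simp [h]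
  set Ψ₀ : Total → Total := fun q => (((q.1.1.1 + c₀, ε * q.1.1.2.1, ε * q.1.1.2.2 + c₁),
    c₂ * q.1.2 + c₃ * (q.1.1.1 * q.1.1.2.1 - q.1.1.2.2) + c₄ * q.1.1.2.1 + c₅), q.2) with hΨ₀
  set Φ : Total → Total := fun q => (((q.1.1.1 - c₀, ε * q.1.1.2.1, ε * (q.1.1.2.2 - c₁)),
    (q.1.2 - c₃ * ((q.1.1.1 - c₀) * (ε * q.1.1.2.1) - ε * (q.1.1.2.2 - c₁)) -
      c₄ * (ε * q.1.1.2.1) - c₅) / c₂), q.2) with hΦ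
  have hO : IsOpen (Ω ×ˢ (univ : Set ℝ)) := hΩ.prod isOpen_univ
  have heq : ∀ q ∈ Ω ×ˢ (univ : Set ℝ), Ψ q = Ψ₀ q := fun q hq =>
    hΨ q.1.1.1 q.1.1.2.1 q.1.1.2.2 q.1.2 q.2 hq.1
  have hinv : ∀ q, Φ (Ψ₀ q) = q := by
    intro q
    refine Prod.ext (Prod.ext (Prod.ext ?_ (Prod.ext ?_ ?_)) ?_) rfl
    · simp [hΦ, hΨ₀]
    · simp only [hΦ, hΨ₀]
      linear_combination q.1.1.2.1 * hε2
    · simp only [hΦ, hΨ₀]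
      linear_combination q.1.1.2.2 * hε2
    · simp only [hΦ, hΨ₀]
      rw [div_eq_iff hc]
      linear_combination (-c₃ * (q.1.1.1 * q.1.1.2.1 - q.1.1.2.2) - c₄ * q.1.1.2.1) * hε2
  refine ⟨?_, ?_, ?_, fun p => (Ψ₀ (p, 0)).1, ?_, fun β => ⟨β, ?_, ?_⟩⟩
  · refine ContDiffOn.congr (f := Ψ₀) ?_ heq
    exact ContDiff.contDiffOn (by fun_prop)
  · intro q hq r hr hqr
    rw [heq q hq, heq r hr] at hqr
    rw [← hinv q, hqr, hinv r]
  · intro q hq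
    refine det_ne_zero_of_leftInverse (Ψ₀ := Ψ₀) (Φ := Φ)
      (Filter.eventuallyEq_of_mem (hO.mem_nhds hq) heq) ?_ ?_ (Eventually.of_forall hinv)
    · fun_prop
    · fun_prop
  · intro p hp β
    rw [heq (p, β) ⟨hp, mem_univ _⟩]
  · intro p hp
    rw [heq (p, β) ⟨hp, mem_univ _⟩]
  · exact mapsEquation_first hΩ hε hc (fun p _ => rfl) β

lemma eventually_sign_eq {x : ℝ} (hx : x ≠ 0) :
    ∀ᶠ r in 𝓝 x, Real.sign r = Real.sign x ∧ r ≠ 0 := by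
  rcases lt_or_gt_of_ne hx with h | h
  · filter_upwards [eventually_lt_nhds h] with r hr
    exact ⟨by rw [Real.sign_of_neg hr, Real.sign_of_neg h], hr.ne⟩
  · filter_upwards [eventually_gt_nhds h] with r hr
    exact ⟨by rw [Real.sign_of_pos hr, Real.sign_of_pos h], hr.ne'⟩

lemma IsSecondForm.isEquivalenceTransformation (hΩ : IsOpen Ω) (h : IsSecondForm Ω Ψ) :
    IsEquivalenceTransformation Ω Ψ := by
  obtain ⟨hx, ε, c₀, c₁, c₂, c₃, c₄, c₅, hε, hc, hΨ⟩ := h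
  have hε2 : ε * ε = 1 := by rcases hε with h | h <;> simp [h]
  have hε0 : ε ≠ 0 := by rcases hε with h | h <;> simp [h]
  -- The transformation with the sign of `x` replaced by a constant, and its inverse.
  set Ψ₀ : ℝ → Total → Total := fun σ q => (((σ * q.1.1.2.2 + c₀, ε / q.1.1.2.1,
    ε * σ * q.1.1.1 + c₁), c₂ / q.1.1.2.1 * q.1.2 + c₃ * (q.1.1.1 - q.1.1.2.2 / q.1.1.2.1) +
    c₄ / q.1.1.2.1 + c₅), 5 - q.2) with hΨ₀
  set Φ : ℝ → Total → Total := fun σ q => (((ε * σ * (q.1.1.2.2 - c₁), ε / q.1.1.2.1,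
    σ * (q.1.1.1 - c₀)), ((q.1.2 - c₃ * (ε * σ * (q.1.1.2.2 - c₁) - σ * (q.1.1.1 - c₀) *
    (ε * q.1.1.2.1)) - c₄ * (ε * q.1.1.2.1) - c₅) * (ε / q.1.1.2.1)) / c₂), 5 - q.2) with hΦ
  have hO : IsOpen (Ω ×ˢ (univ : Set ℝ)) := hΩ.prod isOpen_univ
  have heq : ∀ q ∈ Ω ×ˢ (univ : Set ℝ), Ψ q = Ψ₀ (Real.sign q.1.1.2.1) q := fun q hq =>
    hΨ q.1.1.1 q.1.1.2.1 q.1.1.2.2 q.1.2 q.2 hq.1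
  have hinv : ∀ σ : ℝ, σ * σ = 1 → ∀ q : Total, q.1.1.2.1 ≠ 0 → Φ σ (Ψ₀ σ q) = q := by
    intro σ hσ q hq
    refine Prod.ext (Prod.ext (Prod.ext ?_ (Prod.ext ?_ ?_)) ?_) ?_
    · simp only [hΦ, hΨ₀]
      linear_combination q.1.1.1 * hσ + q.1.1.1 * σ * σ * hε2
    · simp only [hΦ, hΨ₀]
      field_simp
    · simp only [hΦ, hΨ₀]
      linear_combination q.1.1.2.2 * hσ
    · simp only [hΦ, hΨ₀]
      have e1 : ε * (ε / q.1.1.2.1) = 1 / q.1.1.2.1 := by rw [← mul_div_assoc, hε2]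
      have e2 : ε / (ε / q.1.1.2.1) = q.1.1.2.1 := by field_simp
      have e3 : ε * σ * (ε * σ * q.1.1.1 + c₁ - c₁) = q.1.1.1 := by
        linear_combination q.1.1.1 * hσ + q.1.1.1 * σ * σ * hε2
      have e4 : σ * (σ * q.1.1.2.2 + c₀ - c₀) = q.1.1.2.2 := by
        linear_combination q.1.1.2.2 * hσ
      rw [e1, e2, e3, e4]
      field_simp
      ring
    · simp [hΦ, hΨ₀]
  have hσ : ∀ q ∈ Ω ×ˢ (univ : Set ℝ), Real.sign q.1.1.2.1 * Real.sign q.1.1.2.1 = 1 := by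
    intro q hq
    rcases Real.sign_apply_eq_of_ne_zero _ (hx q.1 hq.1) with h | h <;> rw [h] <;> norm_num
  have hloc : ∀ q ∈ Ω ×ˢ (univ : Set ℝ), Ψ =ᶠ[𝓝 q] Ψ₀ (Real.sign q.1.1.2.1) := by
    intro q hq
    have hcx : Tendsto (fun r : Total => r.1.1.2.1) (𝓝 q) (𝓝 q.1.1.2.1) :=
      (by fun_prop : ContinuousAt (fun r : Total => r.1.1.2.1) q)
    filter_upwards [hO.mem_nhds hq, hcx.eventually (eventually_sign_eq (hx q.1 hq.1))] with r h1 h2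
    rw [heq r h1, h2.1]
  have hsm : ∀ σ, ∀ q ∈ Ω ×ˢ (univ : Set ℝ), ContDiffAt ℝ ∞ (Ψ₀ σ) q := by
    intro σ q hq
    have hq0 := hx q.1 hq.1
    have h1 : ContDiffAt ℝ ∞ (fun r : Total => r.1.1.2.1) q := by fun_prop
    have h2 := h1.inv hq0
    simp only [hΨ₀, div_eq_mul_inv]
    fun_prop
  refine ⟨?_, ?_, ?_, fun p => (Ψ₀ (Real.sign p.1.2.1) (p, 0)).1, ?_, fun β => ⟨5 - β, ?_, ?_⟩⟩
  · intro q hq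
    exact ((hsm _ q hq).congr_of_eventuallyEq (hloc q hq)).contDiffWithinAt
  · intro q hq r hr hqr
    rw [heq q hq, heq r hr] at hqr
    have h1 : ε / q.1.1.2.1 = ε / r.1.1.2.1 := congrArg (fun w : Total => w.1.1.2.1) hqr
    have h2 : q.1.1.2.1 = r.1.1.2.1 := by
      rw [div_eq_div_iff (hx q.1 hq.1) (hx r.1 hr.1)] at h1
      exact (mul_left_cancel₀ hε0 h1).symm
    rw [← hinv _ (hσ q hq) q (hx q.1 hq.1), hqr, h2, hinv _ (hσ r hr) r (hx r.1 hr.1)]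
  · intro q hq
    have hq0 := hx q.1 hq.1
    refine det_ne_zero_of_leftInverse (hloc q hq) (Φ := Φ (Real.sign q.1.1.2.1))
      ((hsm _ q hq).differentiableAt (by simp)) ?_ ?_
    · have h1 : (Ψ₀ (Real.sign q.1.1.2.1) q).1.1.2.1 ≠ 0 := div_ne_zero hε0 hq0
      generalize Ψ₀ (Real.sign q.1.1.2.1) q = r at h1
      have h2 : DifferentiableAt ℝ (fun w : Total => w.1.1.2.1⁻¹) r :=
        (by fun_prop : DifferentiableAt ℝ (fun w : Total => w.1.1.2.1) r).fun_inv h1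
      simp only [hΦ, div_eq_mul_inv]
      fun_prop
    · have hcx : ContinuousAt (fun r : Total => r.1.1.2.1) q := by fun_prop
      filter_upwards [hcx.eventually_ne hq0] with r hr
      exact hinv _ (hσ q hq) r hr
  · intro p hp β
    rw [heq (p, β) ⟨hp, mem_univ _⟩]
  · intro p hp
    rw [heq (p, β) ⟨hp, mem_univ _⟩]
  · exact mapsEquation_second hΩ hε hc (fun p _ => rfl) β

/-- The transformation of the variables that belongs to an equivalence transformation, and the
transformation of the parameter. -/
lemma IsEquivalenceTransformation.exists_components (hΩ : IsOpen Ω)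
    (h : IsEquivalenceTransformation Ω Ψ) :
    ∃ (φ : Vars → Vars) (b : ℝ → ℝ), (∀ p ∈ Ω, ∀ β, Ψ (p, β) = (φ p, b β)) ∧
      ContDiffOn ℝ ∞ φ Ω ∧ (∀ p ∈ Ω, ∀ v, fderiv ℝ φ p v = 0 → v = 0) ∧
      ∀ β, MapsEquation Ω φ β (b β) := by
  obtain ⟨φ, hφ, hb⟩ := h.maps_class
  choose b hb hmaps using hb
  have hO : IsOpen (Ω ×ˢ (univ : Set ℝ)) := hΩ.prod isOpen_univ
  have hΨ : ∀ p ∈ Ω, ∀ β, Ψ (p, β) = (φ p, b β) := fun p hp β =>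
    Prod.ext (hφ p hp β) (hb β p hp)
  have hι : ContDiff ℝ ∞ (fun p : Vars => ((p, 0) : Total)) := by fun_prop
  have hcomp : ContDiffOn ℝ ∞ (fun p : Vars => Ψ (p, 0)) Ω :=
    h.smooth.comp hι.contDiffOn fun p hp => ⟨hp, mem_univ _⟩
  have hsm : ContDiffOn ℝ ∞ φ Ω :=
    hcomp.fst.congr fun p hp => (hφ p hp 0).symm
  refine ⟨φ, b, hΨ, hsm, ?_, hmaps⟩
  intro p hp v hv
  have hq : ((p, 0) : Total) ∈ Ω ×ˢ (univ : Set ℝ) := ⟨hp, mem_univ _⟩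
  have hd : HasFDerivAt Ψ (fderiv ℝ Ψ (p, 0)) (p, 0) :=
    ((h.smooth.contDiffAt (hO.mem_nhds hq)).differentiableAt (by simp)).hasFDerivAt
  have hι' : HasFDerivAt (fun p : Vars => ((p, 0) : Total)) (ContinuousLinearMap.inl ℝ Vars ℝ) p :=
    (hasFDerivAt_id p).prodMk (hasFDerivAt_const 0 p)
  have h1 := hd.comp p hι'
  have h2 : HasFDerivAt (fun p => (φ p, b 0)) _ p :=
    ((hsm.contDiffAt (hΩ.mem_nhds hp)).differentiableAt (by simp)).hasFDerivAt.prodMk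
      (hasFDerivAt_const (b 0) p)
  have h3 := h1.unique (h2.congr_of_eventuallyEq
    (Filter.eventuallyEq_of_mem (hΩ.mem_nhds hp) fun q hq => hΨ q hq 0))
  have h4 : fderiv ℝ Ψ (p, 0) (v, 0) = 0 := by
    have := congrArg (fun A : Vars →L[ℝ] Total => A v) h3
    exact this.trans (Prod.ext hv rfl)
  have hinj : Function.Injective (fderiv ℝ Ψ (p, 0)) :=
    (LinearMap.equivOfDetNeZero (fderiv ℝ Ψ (p, 0) : Total →ₗ[ℝ] Total)
      (h.jacobian_ne_zero _ hq)).injective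
  have h5 := hinj (h4.trans (map_zero _).symm)
  exact congrArg Prod.fst h5

/-- An open set contains two points that differ in `u` only. Such points are separated by an
injective transformation, which forces `c₂ ≠ 0`. -/
lemma exists_ne_same_base (hΩ : IsOpen Ω) (hne : Ω.Nonempty) :
    ∃ (z : Base) (u v : ℝ), u ≠ v ∧ (z, u) ∈ Ω ∧ (z, v) ∈ Ω := by
  obtain ⟨p, hp⟩ := hne
  have h1 := (eventually_line hΩ hp eu).filter_mono (nhdsWithin_le_nhds (s := {0}ᶜ))
  obtain ⟨s, hs, hs0⟩ := (h1.and (eventually_mem_nhdsWithin)).exists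
  refine ⟨p.1, p.2, p.2 + s, ?_, hp, ?_⟩
  · intro h
    exact hs0 (by simpa using h)
  · convert hs using 1
    refine Prod.ext ?_ ?_ <;> simp

/-- On a connected domain every equivalence transformation is of one of the two forms. -/
lemma IsEquivalenceTransformation.form (hΩ : IsOpen Ω) (hc : IsConnected Ω)
    (h : IsEquivalenceTransformation Ω Ψ) : IsFirstForm Ω Ψ ∨ IsSecondForm Ω Ψ := by
  obtain ⟨φ, b, hΨ, hsm, hinj, hmaps⟩ := h.exists_components hΩ
  obtain ⟨z, u, v, huv, hzu, hzv⟩ := exists_ne_same_base hΩ hc.nonempty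
  have hsep : φ (z, u) ≠ φ (z, v) := by
    intro h1
    have h2 : Ψ ((z, u), 0) = Ψ ((z, v), 0) := by rw [hΨ _ hzu, hΨ _ hzv, h1]
    have h3 := h.injOn (x₁ := ((z, u), 0)) (x₂ := ((z, v), 0)) ⟨hzu, mem_univ _⟩
      ⟨hzv, mem_univ _⟩ h2
    exact huv (congrArg (fun q : Total => q.1.2) h3)
  rcases classify hΩ hc hsm hinj hmaps with ⟨hb, ε, c₀, c₁, c₂, c₃, c₄, c₅, hε, hφ⟩ |
    ⟨hb, hx, ε, c₀, c₁, c₂, c₃, c₄, c₅, hε, hφ⟩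
  · refine Or.inl ⟨ε, c₀, c₁, c₂, c₃, c₄, c₅, hε, ?_, ?_⟩
    · rintro rfl
      apply hsep
      rw [hφ _ hzu, hφ _ hzv]
      simp
    · intro t x y u β hp
      rw [hΨ _ hp, hφ _ hp, hb]
  · refine Or.inr ⟨hx, ε, c₀, c₁, c₂, c₃, c₄, c₅, hε, ?_, ?_⟩
    · rintro rfl
      apply hsep
      rw [hφ _ hzu, hφ _ hzv]
      simp
    · intro t x y u β hp
      rw [hΨ _ hp, hφ _ hp, hb]

/-- The second family is the composition of the first one with the discrete transformation; the
constant `c₃` is multiplied by `-sgn x`. -/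
lemma isSecondForm_iff_comp_discreteJ (hc : IsConnected Ω) (hx : ∀ p ∈ Ω, p.1.2.1 ≠ 0) :
    IsSecondForm Ω Ψ ↔ ∃ A : Total → Total, IsFirstForm univ A ∧
      EqOn Ψ (A ∘ discreteJ) (Ω ×ˢ univ) := by
  obtain ⟨s, hs, hsign⟩ := exists_sign hc hx
  have hs2 : s * s = 1 := by rcases hs with h | h <;> simp [h]
  have aux : ∀ (ε c₀ c₁ c₂ c₃ c₄ c₅ : ℝ) (q : Total), q ∈ Ω ×ˢ (univ : Set ℝ) →
      ((((q.1.1.2.2 * Real.sign q.1.1.2.1 + c₀, ε * (1 / q.1.1.2.1),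
        ε * (q.1.1.1 * Real.sign q.1.1.2.1) + c₁), c₂ * (q.1.2 / q.1.1.2.1) + -(s * c₃) *
        (q.1.1.2.2 * Real.sign q.1.1.2.1 * (1 / q.1.1.2.1) - q.1.1.1 * Real.sign q.1.1.2.1) +
        c₄ * (1 / q.1.1.2.1) + c₅), 5 - q.2) : Total) =
      (((Real.sign q.1.1.2.1 * q.1.1.2.2 + c₀, ε / q.1.1.2.1,
        ε * Real.sign q.1.1.2.1 * q.1.1.1 + c₁), c₂ / q.1.1.2.1 * q.1.2 +
        c₃ * (q.1.1.1 - q.1.1.2.2 / q.1.1.2.1) + c₄ / q.1.1.2.1 + c₅), 5 - q.2) := by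
    intro ε c₀ c₁ c₂ c₃ c₄ c₅ q hq
    rw [hsign q.1 hq.1]
    refine Prod.ext (Prod.ext (Prod.ext ?_ (Prod.ext ?_ ?_)) ?_) rfl
    · simp only
      ring
    · simp only
      ring
    · simp only
      ring
    · simp only
      linear_combination c₃ * (q.1.1.1 - q.1.1.2.2 / q.1.1.2.1) * hs2
  constructor
  · rintro ⟨-, ε, c₀, c₁, c₂, c₃, c₄, c₅, hε, hc2, hΨ⟩
    refine ⟨fun q => (((q.1.1.1 + c₀, ε * q.1.1.2.1, ε * q.1.1.2.2 + c₁),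
      c₂ * q.1.2 + -(s * c₃) * (q.1.1.1 * q.1.1.2.1 - q.1.1.2.2) + c₄ * q.1.1.2.1 + c₅), q.2),
      ⟨ε, c₀, c₁, c₂, -(s * c₃), c₄, c₅, hε, hc2, fun t x y u β _ => rfl⟩, ?_⟩
    intro q hq
    rw [show Ψ q = _ from hΨ q.1.1.1 q.1.1.2.1 q.1.1.2.2 q.1.2 q.2 hq.1]
    exact (aux ε c₀ c₁ c₂ c₃ c₄ c₅ q hq).symm
  · rintro ⟨A, ⟨ε, c₀, c₁, c₂, c₃, c₄, c₅, hε, hc2, hA⟩, hΨ⟩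
    refine ⟨hx, ε, c₀, c₁, c₂, -(s * c₃), c₄, c₅, hε, hc2, ?_⟩
    intro t x y u β hp
    have hq : ((((t, x, y), u), β) : Total) ∈ Ω ×ˢ (univ : Set ℝ) := ⟨hp, mem_univ _⟩
    rw [hΨ hq, ← aux ε c₀ c₁ c₂ (-(s * c₃)) c₄ c₅ _ hq]
    have h1 : -(s * -(s * c₃)) = c₃ := by linear_combination c₃ * hs2
    rw [h1]
    exact hA _ _ _ _ _ (mem_univ _)

end Assembly

end KolmogorovPower

theorem mainTheorem2 :
    -- on a connected domain the equivalence transformations are exactly those of the two forms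
    (∀ (Ω : Set KolmogorovPower.Vars), IsOpen Ω → IsConnected Ω →
      ∀ Ψ : KolmogorovPower.Total → KolmogorovPower.Total,
        KolmogorovPower.IsEquivalenceTransformation Ω Ψ ↔
          (KolmogorovPower.IsFirstForm Ω Ψ ∨ KolmogorovPower.IsSecondForm Ω Ψ)) ∧
    -- transformations of the two forms are equivalence transformations on every open domain
    (∀ (Ω : Set KolmogorovPower.Vars), IsOpen Ω →
      ∀ Ψ : KolmogorovPower.Total → KolmogorovPower.Total,
        (KolmogorovPower.IsFirstForm Ω Ψ ∨ KolmogorovPower.IsSecondForm Ω Ψ) →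
          KolmogorovPower.IsEquivalenceTransformation Ω Ψ) ∧
    -- the second family consists of the compositions of the first one with the discrete one
    (∀ (Ω : Set KolmogorovPower.Vars), IsOpen Ω → IsConnected Ω → (∀ p ∈ Ω, p.1.2.1 ≠ 0) →
      ∀ Ψ : KolmogorovPower.Total → KolmogorovPower.Total,
        KolmogorovPower.IsSecondForm Ω Ψ ↔
          ∃ A : KolmogorovPower.Total → KolmogorovPower.Total,
            KolmogorovPower.IsFirstForm Set.univ A ∧
            Set.EqOn Ψ (A ∘ KolmogorovPower.discreteJ) (Ω ×ˢ Set.univ)) := by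
  have two : ∀ (Ω : Set KolmogorovPower.Vars), IsOpen Ω →
      ∀ Ψ : KolmogorovPower.Total → KolmogorovPower.Total,
        (KolmogorovPower.IsFirstForm Ω Ψ ∨ KolmogorovPower.IsSecondForm Ω Ψ) →
          KolmogorovPower.IsEquivalenceTransformation Ω Ψ := by
    rintro Ω hΩ Ψ (h | h)
    · exact h.isEquivalenceTransformation hΩ
    · exact h.isEquivalenceTransformation hΩ
  exact ⟨fun Ω hΩ hc Ψ => ⟨fun h => h.form hΩ hc, two Ω hΩ Ψ⟩, two,
    fun Ω _ hc hx Ψ => KolmogorovPower.isSecondForm_iff_comp_discreteJ hc hx⟩
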